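/- All groups are finite. For a group $G$, $\pi(G)$ is the set of prime divisors of $|G|$, and $O_p(G)$ is the largest normal $p$-subgroup of $G$. Subgroups $H$ and $X$ of $G$ permute if $HX=XH$. A subgroup $H$ of $G$ is semipermutable in $G$ if $H$ permutes with every subgroup $X$ of $G$ such that $(|H|,|X|)=1$. It is SS-permutable in $G$ if there is a subgroup $K$ of $G$ with $G=HK$ such that $H$ permutes with every Sylow subgroup of $K$. A group $G$ is a BT-group (resp. an SST-group) if for all subgroups $H\le K\le G$ such that $H$ is semipermutable (resp. SS-permutable) in $K$ and $K$ is semipermutable (resp. SS-permutable) in $G$, the subgroup $H$ is semipermutable (resp. SS-permutable) in $G$. The nilpotent residual of $G$ is the smallest normal subgroup $L$ of $G$ such that $G/L$ is nilpotent. For subgroups $K,L\le G$, $\langle K^L\rangle$ denotes the subgroup generated by all conjugates of $K$ by elements of $L$; for $x\in G$ and $H\le G$, $[x,H]$ denotes the subgroup generated by the commutators $[x,h]$ with $h\in H$. **Theorem F.** Let $G$ be a finite solvable BT-group with nilpotent residual $L$. Then the following statements are equivalent: (1) $G$ is an SST-group. (2) For every prime $p\in\pi(G)\setminus\pi(L)$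 and every $p$-subgroup $P$ of $G$, there is a $p$-subgroup $K_p$ of $G$ such that the product set $PK_p$ is a Sylow $p$-subgroup of $G$ and $[P,\langle K_p^L\rangle]\le O_p(G)$. (3) For every prime $p\in\pi(G)\setminus\pi(L)$ and every $p$-element $x$ of $G$, there is a $p$-subgroup $K_p$ of $G$ such that the product set $\langle x\rangle K_p$ is a Sylow $p$-subgroup of $G$ and $[x,\langle K_p^L\rangle]\le O_p(G)$. -/

import Mathlib

open scoped Pointwise

namespace SSPerm

variable {G : Type*} [Group G]

/-- `H` permutes with `K`: `HK = KH` as subsets of the group. -/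
def Permutes (H K : Subgroup G) : Prop :=
  (H : Set G) * (K : Set G) = (K : Set G) * (H : Set G)

/-- `K` is a supplement of `H` in `G`: `HK = G`. -/
def IsSupplement (H K : Subgroup G) : Prop :=
  (H : Set G) * (K : Set G) = Set.univ

/-- `H` is semipermutable in `G`: it permutes with every subgroup of order coprime to `|H|`. -/
def IsSemipermutable (H : Subgroup G) : Prop :=
  ∀ X : Subgroup G, (Nat.card H).Coprime (Nat.card X) → Permutes H X

/-- `H` is SS-permutable in `G`: it has a supplement `K` in `G` such that `H` permutes with
every Sylow subgroup of `K`. -/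
def IsSSPermutable (H : Subgroup G) : Prop :=
  ∃ K : Subgroup G, IsSupplement H K ∧
    ∀ p : ℕ, p.Prime → ∀ Q : Sylow p K, Permutes H ((Q : Subgroup K).map K.subtype)

variable (G)

/-- `G` is a BT-group: semipermutability is a transitive relation on its subgroups. -/
def IsBTGroup : Prop :=
  ∀ H K : Subgroup G, H ≤ K → IsSemipermutable (H.subgroupOf K) → IsSemipermutable K →
    IsSemipermutable H

/-- `G` is an SST-group: SS-permutability is a transitive relation on its subgroups. -/
def IsSSTGroup : Prop :=
  ∀ H K : Subgroup G, H ≤ K → IsSSPermutable (H.subgroupOf K) → IsSSPermutable K →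
    IsSSPermutable H

/-- The nilpotent residual of `G`: the intersection of all normal subgroups with nilpotent
quotient (for finite `G`, the smallest such subgroup). -/
def nilpotentResidual : Subgroup G :=
  sInf {N : Subgroup G | ∃ _ : N.Normal, Group.IsNilpotent (G ⧸ N)}

/-- `O_p(G)`: the subgroup generated by all normal `p`-subgroups of `G`
(for finite `G`, the largest normal `p`-subgroup). -/
def pCore (p : ℕ) : Subgroup G :=
  sSup {N : Subgroup G | N.Normal ∧ IsPGroup p N}

variable {G}

/-- `⟨K^L⟩`: the subgroup generated by all conjugates of `K` by elements of `L`. -/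
def conjClosure (K L : Subgroup G) : Subgroup G :=
  ⨆ l : L, K.map (MulAut.conj (l : G)).toMonoidHom

/-- `[x, H]` for an element `x`: the subgroup generated by all
`[x, h] = x⁻¹h⁻¹xh` with `h ∈ H`. -/
def elemCommutator (x : G) (H : Subgroup G) : Subgroup G :=
  Subgroup.closure {g : G | ∃ h ∈ H, x⁻¹ * h⁻¹ * x * h = g}

/-- The product set `PK` is a Sylow `p`-subgroup of `G`. -/
def IsSylowProduct (p : ℕ) (P K : Subgroup G) : Prop :=
  ∃ S : Sylow p G, (S : Set G) = (P : Set G) * (K : Set G)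

end SSPerm

/-!
In a BT-group every element of order prime to `p` sends each element of `O_p(G)` to a power of it.
Such actions on the elements of order `p` commute with one another, hence the nilpotent residual `L`
centralises every `O_p(G)`, and `L` is abelian when `G` is solvable. Then `L` is a Hall subgroup all
of whose subgroups are normal in `G`, so that `G / C(L)` is abelian, and for `p ∤ |L|` a `p`-element
lies in `O_p(G)` exactly when it commutes with all elements of prime order of `L`.

If a `p`-subgroup `P` has a supplement `K` whose Sylow subgroups permute with `P`, then `L ≤ K`, and
a Sylow `p`-subgroup of `K` together with its `L`-conjugates commutes with `P` modulo `O_p(G)`.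
Conversely, (3) says that an element of `L` of prime order which is moved by `x` is centralised by
the cofactor of `⟨x⟩`. This forces a Sylow `p`-subgroup to be generated modulo `O_p(G)` by any of
its elements outside `O_p(G)`. A subgroup `H` therefore has the supplement `⋂ O^p(G) O_p(G)`, over
the primes `p ∤ |L|` for which `H` has a `p`-element outside `O_p(G)`, and it permutes with the
Sylow subgroups of that supplement.
-/

namespace SSPerm

open Subgroup (zpowers centralizer)
open scoped commutatorElement

section PElement

variable {G : Type*} [Group G] {p : ℕ} {x y : G}

/-- `x` is a `p`-element: its order is a power of `p`. -/
def IsPElement (p : ℕ) (x : G) : Prop := ∃ k : ℕ, x ^ p ^ k = 1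

theorem IsPElement.map {H : Type*} [Group H] (hx : IsPElement p x) (f : G →* H) :
    IsPElement p (f x) := by
  obtain ⟨k, hk⟩ := hx
  exact ⟨k, by rw [← map_pow, hk, map_one]⟩

theorem IsPElement.zpow (hx : IsPElement p x) (n : ℤ) : IsPElement p (x ^ n) := by
  obtain ⟨k, hk⟩ := hx
  exact ⟨k, by rw [← zpow_natCast, zpow_comm, zpow_natCast, hk, one_zpow]⟩

theorem isPElement_of_mem {P : Subgroup G} (hP : IsPGroup p P) (hx : x ∈ P) : IsPElement p x := by
  obtain ⟨k, hk⟩ := isPGroup_iff_pow_pow_eq_one.1 hP ⟨x, hx⟩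
  exact ⟨k, congrArg Subtype.val hk⟩

theorem isPGroup_of_forall_isPElement {P : Subgroup G} (h : ∀ x ∈ P, IsPElement p x) :
    IsPGroup p P :=
  isPGroup_iff_pow_pow_eq_one.2 fun x ↦ (h x x.2).imp fun _ hk ↦ Subtype.ext hk

theorem IsPElement.isPGroup_zpowers (hx : IsPElement p x) : IsPGroup p (zpowers x) := by
  refine isPGroup_of_forall_isPElement ?_
  rintro _ ⟨n, rfl⟩
  exact hx.zpow n

theorem IsPElement.exists_mem_sylow (hx : IsPElement p x) : ∃ S : Sylow p G, x ∈ S :=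
  hx.isPGroup_zpowers.exists_le_sylow.imp fun _ hS ↦ hS (Subgroup.mem_zpowers x)

theorem IsPElement.coprime_orderOf (hx : IsPElement p x) {n : ℕ} (hpn : p.Coprime n) :
    (orderOf x).Coprime n := by
  obtain ⟨k, hk⟩ := hx
  exact (hpn.pow_left k).coprime_dvd_left (orderOf_dvd_of_pow_eq_one hk)

theorem IsPElement.dvd_orderOf (hp : p.Prime) (hx : IsPElement p x) (h1 : x ≠ 1) :
    p ∣ orderOf x := by
  by_contra h
  have := hx.coprime_orderOf ((Nat.Prime.coprime_iff_not_dvd hp).2 h)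
  exact h1 (orderOf_eq_one_iff.1 ((Nat.coprime_self _).1 this))

theorem IsPElement.dvd_natCard (hp : p.Prime) (hx : IsPElement p x) (h1 : x ≠ 1)
    {H : Subgroup G} (hxH : x ∈ H) : p ∣ Nat.card H :=
  (hx.dvd_orderOf hp h1).trans (H.orderOf_dvd_natCard hxH)

theorem IsPElement.eq_one_of_mem (hp : p.Prime) (hx : IsPElement p x) {H : Subgroup G}
    (hxH : x ∈ H) (h : ¬ p ∣ Nat.card H) : x = 1 :=
  by_contra fun h1 ↦ h (hx.dvd_natCard hp h1 hxH)

theorem mem_of_zpow_mem_of_isCoprime {H : Subgroup G} {m n : ℤ} (h : IsCoprime m n)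
    (hm : x ^ m ∈ H) (hn : x ^ n ∈ H) : x ∈ H := by
  obtain ⟨a, b, hab⟩ := h
  have hx : (x ^ m) ^ a * (x ^ n) ^ b = x := by
    rw [← zpow_mul', ← zpow_mul', ← zpow_add, hab, zpow_one]
  exact hx ▸ H.mul_mem (H.zpow_mem hm a) (H.zpow_mem hn b)

theorem mem_of_pow_mem_of_coprime {H : Subgroup G} {m n : ℕ} (h : m.Coprime n)
    (hm : x ^ m ∈ H) (hn : x ^ n ∈ H) : x ∈ H :=
  mem_of_zpow_mem_of_isCoprime (Nat.isCoprime_iff_coprime.2 h) (by rwa [zpow_natCast])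
    (by rwa [zpow_natCast])

theorem IsPElement.mem_of_zpow_mem (hp : p.Prime) (hx : IsPElement p x) {H : Subgroup G} {n : ℤ}
    (hn : ¬ (p : ℤ) ∣ n) (h : x ^ n ∈ H) : x ∈ H := by
  obtain ⟨k, hk⟩ := hx
  have hcop : IsCoprime n ((p ^ k : ℕ) : ℤ) := by
    push_cast
    exact ((Nat.prime_iff_prime_int.1 hp).coprime_iff_not_dvd.2 hn).symm.pow_right
  refine mem_of_zpow_mem_of_isCoprime hcop h ?_
  rw [zpow_natCast, hk]
  exact H.one_mem

theorem IsPElement.dvd_of_zpow_eq_one (hp : p.Prime) (hx : IsPElement p x) (h1 : x ≠ 1) {n : ℤ}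
    (h : x ^ n = 1) : (p : ℤ) ∣ n :=
  (Int.natCast_dvd_natCast.2 (hx.dvd_orderOf hp h1)).trans (orderOf_dvd_iff_zpow_eq_one.2 h)

theorem commute_of_pow_coprime {m n : ℕ} (h : m.Coprime n) (hm : Commute (x ^ m) y)
    (hn : Commute (x ^ n) y) : Commute x y :=
  Subgroup.mem_centralizer_singleton_iff.1 <| mem_of_pow_mem_of_coprime h
    (Subgroup.mem_centralizer_singleton_iff.2 hm) (Subgroup.mem_centralizer_singleton_iff.2 hn)

end PElement

section CyclicAction

variable {G : Type*} [Group G] {p q m : ℕ} {v w : G}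

theorem commutatorElement_pow_of_commute (h : Commute v ⁅v, w⁆) (n : ℕ) :
    ⁅v, w⁆ ^ n = ⁅v ^ n, w⁆ := by
  have hconj : w * v⁻¹ * w⁻¹ = v⁻¹ * ⁅v, w⁆ := by rw [commutatorElement_def]; group
  have hcomm : Commute v (w * v⁻¹ * w⁻¹) :=
    hconj ▸ (Commute.refl v).inv_right.mul_right h
  calc ⁅v, w⁆ ^ n = (v * (w * v⁻¹ * w⁻¹)) ^ n := by simp only [commutatorElement_def, mul_assoc]
    _ = v ^ n * (w * (v ^ n)⁻¹ * w⁻¹) := by rw [hcomm.mul_pow, conj_pow, inv_pow]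
    _ = ⁅v ^ n, w⁆ := by simp only [commutatorElement_def, mul_assoc]

theorem conj_pow_eq_zpow_pow {n : ℤ} (h : w * v * w⁻¹ = v ^ n) (m : ℕ) :
    w ^ m * v * (w ^ m)⁻¹ = v ^ n ^ m := by
  induction m with
  | zero => simp
  | succ m ih =>
    calc w ^ (m + 1) * v * (w ^ (m + 1))⁻¹ = w * (w ^ m * v * (w ^ m)⁻¹) * w⁻¹ := by
          rw [pow_succ']; group
      _ = v ^ n ^ (m + 1) := by rw [ih, ← conj_zpow, h, ← zpow_mul, pow_succ']

theorem commute_of_conj_eq_zpow (hv : IsPElement p v) {n : ℤ}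
    (h : w * v * w⁻¹ = v ^ n) (hn : (p : ℤ) ∣ n - 1) (hm : p.Coprime m)
    (hwm : Commute (w ^ m) v) : Commute w v := by
  obtain ⟨k, hk⟩ := hv
  -- `n ≡ 1` modulo `p` gives `n ^ p ^ k ≡ 1` modulo `p ^ k`.
  have hdvd : ((p ^ k : ℕ) : ℤ) ∣ n ^ p ^ k - 1 := by
    have := dvd_sub_pow_of_dvd_sub hn k
    rw [one_pow, pow_succ] at this
    exact_mod_cast dvd_of_mul_right_dvd this
  have hwp : Commute (w ^ p ^ k) v := by
    refine mul_inv_eq_iff_eq_mul.1 ((conj_pow_eq_zpow_pow h _).trans ?_)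
    obtain ⟨c, hc⟩ := hdvd
    rw [← sub_add_cancel (n ^ p ^ k) 1, hc, zpow_add, zpow_mul, zpow_natCast, hk, one_zpow,
      one_mul, zpow_one]
  exact commute_of_pow_coprime (hm.pow_left k) hwp hwm

theorem commute_of_forall_commute_prime_order (hp : p.Prime) (hv : IsPElement p v)
    (hw : w * v * w⁻¹ ∈ zpowers v) (hm : p.Coprime m) (hwm : Commute (w ^ m) v)
    (h : ∀ u ∈ zpowers v, orderOf u = p → Commute w u) : Commute w v := by
  obtain rfl | hv1 := eq_or_ne v 1
  · exact Commute.one_right w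
  obtain ⟨n, hn : v ^ n = w * v * w⁻¹⟩ := hw
  refine commute_of_conj_eq_zpow hv hn.symm ?_ hm hwm
  set u := v ^ (orderOf v / p) with hu_def
  have hv0 : orderOf v ≠ 0 := by
    obtain ⟨k, hk⟩ := hv
    exact (isOfFinOrder_iff_pow_eq_one.2 ⟨_, pow_pos hp.pos k, hk⟩).orderOf_pos.ne'
  have hu : orderOf u = p := orderOf_pow_orderOf_div hv0 (hv.dvd_orderOf hp hv1)
  have hwu : w * u * w⁻¹ = u ^ n := by
    rw [hu_def, ← conj_pow, ← hn, ← zpow_natCast, ← zpow_natCast, zpow_comm]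
  have hfix : w * u * w⁻¹ = u :=
    mul_inv_eq_iff_eq_mul.2 (h u (Subgroup.npow_mem_zpowers v _) hu).eq
  rw [← hu, orderOf_dvd_iff_zpow_eq_one, zpow_sub_one, ← hwu, hfix, mul_inv_cancel]

theorem dvd_sub_one_of_not_commute (hp : p.Prime) (hq : q.Prime) (hpq : p ≠ q)
    (hw : IsPElement q w) (hv : IsPElement p v) (h : w * v * w⁻¹ ∈ zpowers v)
    (hc : ¬ Commute w v) : q ∣ p - 1 := by
  obtain ⟨n, hn : v ^ n = w * v * w⁻¹⟩ := h
  obtain ⟨k, hk⟩ := hw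
  have hv1 : v ≠ 1 := by
    rintro rfl
    exact hc (Commute.one_right w)
  have hnk : (p : ℤ) ∣ n ^ q ^ k - 1 := by
    refine hv.dvd_of_zpow_eq_one hp hv1 ?_
    rw [zpow_sub_one, ← conj_pow_eq_zpow_pow hn.symm, hk, one_mul, inv_one, mul_one, mul_inv_cancel]
  have hnp : IsCoprime n p := by
    refine ((Nat.prime_iff_prime_int.1 hp).coprime_iff_not_dvd.2 fun hd ↦ ?_).symm
    have h1 : (p : ℤ) ∣ 1 := by
      simpa using dvd_sub (dvd_pow hd (pow_ne_zero k hq.ne_zero)) hnk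
    exact (Nat.prime_iff_prime_int.1 hp).not_dvd_one h1
  have hpk : p.Coprime (q ^ k) := ((Nat.coprime_primes hp hq).2 hpq).pow_right k
  have hwp : Commute (w ^ (p - 1)) v := by
    refine commute_of_conj_eq_zpow hv (conj_pow_eq_zpow_pow hn.symm (p - 1)) ?_ hpk ?_
    · exact (Int.ModEq.pow_card_sub_one_eq_one hp hnp).symm.dvd
    · rw [← pow_mul, mul_comm, pow_mul, hk, one_pow]
      exact Commute.one_left v
  by_contra hd
  refine hc (commute_of_pow_coprime (((Nat.Prime.coprime_iff_not_dvd hq).2 hd).pow_left k) ?_ hwp)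
  rw [hk]
  exact Commute.one_left v

theorem conj_eq_zpow_of_orderOf_eq (hp : p.Prime) {u z : G} (hz : orderOf z = p)
    (hu : orderOf u = p) (hzu : Commute z u) {n : ℤ} (hzn : w * z * w⁻¹ = z ^ n)
    (hwu : w * u * w⁻¹ ∈ zpowers u) (hwzu : w * (z * u) * w⁻¹ ∈ zpowers (z * u)) :
    w * u * w⁻¹ = u ^ n := by
  by_cases huz : u ∈ zpowers z
  · obtain ⟨i, rfl⟩ := huz
    simp only [← conj_zpow, hzn, ← zpow_mul, mul_comm]
  obtain ⟨c, hc : u ^ c = w * u * w⁻¹⟩ := hwu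
  obtain ⟨d, hd : (z * u) ^ d = w * (z * u) * w⁻¹⟩ := hwzu
  have hpu : IsPElement p u := ⟨1, by rw [pow_one, ← hu, pow_orderOf_eq_one]⟩
  have hpz : IsPElement p z := ⟨1, by rw [pow_one, ← hz, pow_orderOf_eq_one]⟩
  have hprod : z ^ n * u ^ c = z ^ d * u ^ d := by
    rw [← hzu.mul_zpow, hd, ← hzn, hc]
    group
  have heq : u ^ (d - c) = z ^ (n - d) := by
    rw [zpow_sub, sub_eq_neg_add, zpow_add, zpow_neg, eq_inv_mul_iff_mul_eq, ← mul_assoc, ← hprod,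
      mul_inv_cancel_right]
  have hdc : (p : ℤ) ∣ d - c := by
    by_contra h
    exact huz (hpu.mem_of_zpow_mem hp h (heq ▸ Subgroup.zpow_mem_zpowers z _))
  have hnd : (p : ℤ) ∣ n - d := by
    refine hpz.dvd_of_zpow_eq_one hp (fun h ↦ huz ?_) ?_
    · rw [h, orderOf_one] at hz
      exact absurd hz.symm hp.ne_one
    · rw [← heq, ← orderOf_dvd_iff_zpow_eq_one, hu]
      exact hdc
  rw [← hc, zpow_eq_zpow_iff_modEq, hu, Int.modEq_iff_dvd]
  exact sub_add_sub_cancel n d c ▸ dvd_add hnd hdc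

end CyclicAction

section Permutes

variable {G : Type*} [Group G] {H K : Subgroup G}

theorem Permutes.symm (h : Permutes H K) : Permutes K H := Eq.symm h

theorem permutes_of_normal_right (H K : Subgroup G) [K.Normal] : Permutes H K :=
  Subgroup.set_mul_normal_comm (H : Set G) K

theorem permutes_of_normal_left (H K : Subgroup G) [H.Normal] : Permutes H K :=
  (permutes_of_normal_right K H).symm

theorem permutes_iff_forall_mul_mem :
    Permutes H K ↔ ∀ h ∈ H, ∀ k ∈ K, h * k ∈ (K : Set G) * H := by
  refine ⟨fun h ↦ Set.mul_subset_iff.1 h.le, fun h ↦ ?_⟩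
  have hle : (H : Set G) * K ⊆ K * H := Set.mul_subset_iff.2 h
  refine hle.antisymm ?_
  simpa only [mul_inv_rev, inv_coe_set] using Set.inv_subset_inv.2 hle

theorem permutes_of_commute (h : ∀ x ∈ H, ∀ y ∈ K, Commute x y) : Permutes H K :=
  permutes_iff_forall_mul_mem.2 fun x hx y hy ↦ ⟨y, hy, x, hx, (h x hx y hy).symm⟩

theorem permutes_of_le (h : H ≤ K) : Permutes H K :=
  permutes_iff_forall_mul_mem.2 fun x hx y hy ↦
    ⟨x * y, mul_mem (h hx) hy, 1, one_mem H, mul_one _⟩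

theorem permutes_closure {s : Set G} (h : ∀ x ∈ s, Permutes (zpowers x) K) :
    Permutes (Subgroup.closure s) K := by
  have key : ∀ x ∈ s, ∀ y ∈ zpowers x, ∀ z : G,
      (∀ k ∈ K, z * k ∈ (K : Set G) * Subgroup.closure s) →
        ∀ k ∈ K, y * z * k ∈ (K : Set G) * Subgroup.closure s := by
    intro x hx y hy z hz k hk
    obtain ⟨k₁, hk₁, z', hz', h₁⟩ := hz k hk
    obtain ⟨k₂, hk₂, y', hy', h₂⟩ := permutes_iff_forall_mul_mem.1 (h x hx) y hy k₁ hk₁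
    have hy's : y' ∈ Subgroup.closure s :=
      (Subgroup.zpowers_le.2 (Subgroup.subset_closure hx) : zpowers x ≤ _) hy'
    refine ⟨k₂, hk₂, y' * z', mul_mem hy's hz', ?_⟩
    simp only at h₁ h₂ ⊢
    rw [← mul_assoc, h₂, mul_assoc, h₁, mul_assoc]
  refine permutes_iff_forall_mul_mem.2 fun z hz ↦ ?_
  induction hz using Subgroup.closure_induction_left with
  | one => exact fun k hk ↦ ⟨k, hk, 1, one_mem _, by simp⟩
  | mul_left x hx y _ ih => exact key x hx x (Subgroup.mem_zpowers x) y ih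
  | inv_mul_cancel x hx y _ ih => exact key x hx x⁻¹ (inv_mem (Subgroup.mem_zpowers x)) y ih

theorem Permutes.coe_sup (h : Permutes H K) :
    ((H ⊔ K : Subgroup G) : Set G) = (H : Set G) * K := by
  let T : Subgroup G :=
    { carrier := (H : Set G) * K
      one_mem' := ⟨1, H.one_mem, 1, K.one_mem, mul_one 1⟩
      mul_mem' := fun {a b} ha hb ↦ by
        have hTT : ((H : Set G) * K) * (H * K) = H * K := by
          rw [mul_assoc, ← mul_assoc (K : Set G), ← h, mul_assoc, coe_mul_coe, ← mul_assoc,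
            coe_mul_coe]
        exact hTT ▸ Set.mul_mem_mul ha hb
      inv_mem' := fun {a} ha ↦ by
        rw [← Set.mem_inv, mul_inv_rev, inv_coe_set, inv_coe_set]
        exact h ▸ ha }
  have hT : H ⊔ K = T := by
    refine le_antisymm (sup_le ?_ ?_) ?_
    · exact fun x hx ↦ ⟨x, hx, 1, K.one_mem, mul_one x⟩
    · exact fun x hx ↦ ⟨1, H.one_mem, x, hx, one_mul x⟩
    · exact Set.mul_subset_iff.2 fun a ha b hb ↦ Subgroup.mul_mem_sup ha hb
  rw [hT]
  rfl

theorem Permutes.mem_sup (h : Permutes H K) {g : G} :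
    g ∈ H ⊔ K ↔ ∃ x ∈ H, ∃ y ∈ K, x * y = g := by
  rw [← SetLike.mem_coe, h.coe_sup, Set.mem_mul]
  rfl

theorem Permutes.relIndex_sup (h : Permutes H K) : K.relIndex (H ⊔ K) = K.relIndex H := by
  let φ := Subgroup.quotientSubgroupOfEmbeddingOfLE K (le_sup_left : H ≤ H ⊔ K)
  refine (Nat.card_eq_of_bijective φ ⟨φ.injective, fun t ↦ ?_⟩).symm
  induction t using QuotientGroup.induction_on with
  | H t =>
    obtain ⟨x, hx, y, hy, hxy⟩ := h.mem_sup.1 t.2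
    refine ⟨((⟨x, hx⟩ : H) : H ⧸ K.subgroupOf H), QuotientGroup.eq.2 ?_⟩
    rw [Subgroup.mem_subgroupOf]
    simpa [← hxy] using hy

theorem Permutes.card_sup_dvd (h : Permutes H K) :
    Nat.card (H ⊔ K : Subgroup G) ∣ Nat.card H * Nat.card K := by
  rw [← (K.subgroupOf (H ⊔ K)).index_mul_card,
    Nat.card_congr (Subgroup.subgroupOfEquivOfLe (le_sup_right : K ≤ H ⊔ K)).toEquiv]
  refine mul_dvd_mul_right ?_ _
  rw [← Subgroup.relIndex, h.relIndex_sup]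
  exact K.relIndex_dvd_card H

theorem Permutes.isPGroup_sup [Finite G] {p : ℕ} [Fact p.Prime] (h : Permutes H K)
    (hH : IsPGroup p H) (hK : IsPGroup p K) : IsPGroup p (H ⊔ K : Subgroup G) := by
  obtain ⟨a, ha⟩ := IsPGroup.iff_card.1 hH
  obtain ⟨b, hb⟩ := IsPGroup.iff_card.1 hK
  refine IsPGroup.of_card_dvd_pow (n := a + b) ?_
  rw [pow_add, ← ha, ← hb]
  exact h.card_sup_dvd

theorem IsSupplement.symm (h : IsSupplement H K) : IsSupplement K H := by
  rw [IsSupplement, ← Set.inv_univ, ← h, mul_inv_rev, inv_coe_set, inv_coe_set]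

theorem IsSupplement.permutes (h : IsSupplement H K) : Permutes H K := h.trans (Eq.symm h.symm)

theorem IsSupplement.index_eq (h : IsSupplement H K) : K.index = K.relIndex H := by
  have hsup : H ⊔ K = ⊤ := SetLike.coe_injective (h.permutes.coe_sup.trans h)
  rw [← Subgroup.relIndex_top_right, ← hsup, h.permutes.relIndex_sup]

theorem IsSupplement.mono {H' : Subgroup G} (h : IsSupplement H K) (hle : H ≤ H') :
    IsSupplement H' K :=
  Set.eq_univ_of_univ_subset ((Eq.symm h).trans_subset (Set.mul_subset_mul_right hle))

end Permutes

theorem isNilpotent_of_commutator_le_centralizer {G : Type*} [Group G] {D : Subgroup G}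
    (h : ⁅D, D⁆ ≤ centralizer (D : Set G)) : Group.IsNilpotent D :=
  Subgroup.isNilpotent_of_lowerCentralSeries_eq_bot (n := 2)
    (Subgroup.commutator_eq_bot_iff_le_centralizer.2 h)

theorem mem_of_mem_sup_of_coprime {G : Type*} [Group G] {H N : Subgroup G} [N.Normal] {e : G}
    (he : e ∈ H ⊔ N) (h : (orderOf e).Coprime (Nat.card H)) : e ∈ N := by
  obtain ⟨x, hx, n, hn, rfl⟩ := Subgroup.mem_sup_of_normal_right.1 he
  refine mem_of_pow_mem_of_coprime h (pow_orderOf_eq_one (x * n) ▸ one_mem N) ?_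
  rw [← QuotientGroup.eq_one_iff, ← QuotientGroup.mk'_apply, map_pow, map_mul,
    show QuotientGroup.mk' N n = 1 from (QuotientGroup.eq_one_iff _).2 hn, mul_one, ← map_pow,
    orderOf_dvd_iff_pow_eq_one.1 (H.orderOf_dvd_natCard hx), map_one]

section FiniteGroup

variable {G : Type*} [Group G] [Finite G] {p q : ℕ}

theorem eq_top_of_forall_sylow_le {H : Subgroup G}
    (h : ∀ p : ℕ, p.Prime → ∃ P : Sylow p G, (P : Subgroup G) ≤ H) : H = ⊤ := by
  rw [← Subgroup.index_eq_one]
  by_contra hne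
  obtain ⟨p, hp, hd⟩ := Nat.exists_prime_and_dvd hne
  have := Fact.mk hp
  obtain ⟨P, hP⟩ := h p hp
  exact P.not_dvd_index (hd.trans (Subgroup.index_dvd_of_le hP))

theorem le_of_forall_isPElement_mem {A B : Subgroup G}
    (h : ∀ p : ℕ, p.Prime → ∀ x ∈ A, IsPElement p x → x ∈ B) : A ≤ B := by
  rw [← Subgroup.subgroupOf_eq_top]
  refine eq_top_of_forall_sylow_le fun p hp ↦ ⟨Classical.arbitrary _, fun x hx ↦ ?_⟩
  exact h p hp x x.2 ((isPElement_of_mem (Sylow.isPGroup' _) hx).map A.subtype)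

theorem permutes_of_forall_isPElement {H K : Subgroup G}
    (h : ∀ p : ℕ, p.Prime → ∀ x ∈ H, IsPElement p x → Permutes (zpowers x) K) : Permutes H K := by
  let s : Set G := {x | x ∈ H ∧ ∃ p : ℕ, p.Prime ∧ IsPElement p x}
  have hs : H = Subgroup.closure s :=
    le_antisymm
      (le_of_forall_isPElement_mem fun p hp x hx hpx ↦ Subgroup.subset_closure ⟨hx, p, hp, hpx⟩)
      ((Subgroup.closure_le H).2 fun x hx ↦ hx.1)
  rw [hs]
  exact permutes_closure fun x ⟨hx, p, hp, hpx⟩ ↦ h p hp x hx hpx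

theorem not_dvd_card_iff_forall_isPElement (hp : p.Prime) {H : Subgroup G} :
    ¬ p ∣ Nat.card H ↔ ∀ x ∈ H, IsPElement p x → x = 1 := by
  refine ⟨fun h x hx hpx ↦ hpx.eq_one_of_mem hp hx h, fun h hd ↦ ?_⟩
  have := Fact.mk hp
  obtain ⟨x, hx⟩ := exists_prime_orderOf_dvd_card' p hd
  have hx1 : (x : G) = 1 :=
    h x x.2 ⟨1, by rw [pow_one, ← hx, ← Subgroup.orderOf_coe, pow_orderOf_eq_one]⟩
  rw [← Subgroup.orderOf_coe, hx1, orderOf_one] at hx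
  exact hp.ne_one hx.symm

theorem exists_orderOf_eq_and_forall_commute (hp : p.Prime) {V : Subgroup G} (hV : IsPGroup p V)
    (hne : V ≠ ⊥) : ∃ z ∈ V, orderOf z = p ∧ ∀ v ∈ V, Commute z v := by
  have := Fact.mk hp
  have := V.nontrivial_iff_ne_bot.2 hne
  have := hV.center_nontrivial
  obtain ⟨z, hz⟩ := exists_prime_orderOf_dvd_card' p
    ((hV.to_subgroup (Subgroup.center V)).card_eq_or_dvd.resolve_left Finite.one_lt_card.ne')
  refine ⟨z, z.1.2, by rw [Subgroup.orderOf_coe, Subgroup.orderOf_coe, hz], fun v hv ↦ ?_⟩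
  exact (congrArg Subtype.val (Subgroup.mem_center_iff.1 z.2 ⟨v, hv⟩)).symm

theorem commute_of_isNilpotent [Group.IsNilpotent G] (hp : p.Prime) (hq : q.Prime) (hpq : p ≠ q)
    {x y : G} (hx : IsPElement p x) (hy : IsPElement q y) : Commute x y := by
  have := Fact.mk hp
  have := Fact.mk hq
  obtain ⟨P, hP⟩ := hx.exists_mem_sylow
  obtain ⟨Q, hQ⟩ := hy.exists_mem_sylow
  have h := (Group.isNilpotent_of_finite_tfae (G := G)).out 0 3 rfl rfl |>.1 inferInstance
  exact Subgroup.commute_of_normal_of_disjoint (P : Subgroup G) Q (h p ⟨hp⟩ P) (h q ⟨hq⟩ Q)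
    (IsPGroup.disjoint_of_ne p q hpq _ _ P.isPGroup' Q.isPGroup') x y hP hQ

theorem normal_of_forall_exists_sylow_le_normalizer {N : Subgroup G}
    (h : ∀ p : ℕ, p.Prime → ∃ P : Sylow p G, ∀ g ∈ P, ∀ x ∈ N, g * x * g⁻¹ ∈ N) : N.Normal := by
  rw [← Subgroup.normalizer_eq_top_iff]
  refine eq_top_of_forall_sylow_le fun p hp ↦ ?_
  obtain ⟨P, hP⟩ := h p hp
  refine ⟨P, fun g hg ↦ Subgroup.mem_normalizer_iff.2 fun x ↦ ⟨hP g hg x, fun hx ↦ ?_⟩⟩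
  simpa [mul_assoc] using hP g⁻¹ (inv_mem hg) _ hx

theorem normal_of_forall_isPElement_conj_mem {N : Subgroup G}
    (h : ∀ q : ℕ, q.Prime → ∀ g : G, IsPElement q g → ∀ p : ℕ, p.Prime → ∀ x ∈ N,
      IsPElement p x → g * x * g⁻¹ ∈ N) : N.Normal := by
  refine normal_of_forall_exists_sylow_le_normalizer fun q hq ↦ ⟨Classical.arbitrary _, ?_⟩
  exact fun g hg ↦ le_of_forall_isPElement_mem (B := N.comap (MulAut.conj g).toMonoidHom)
    (h q hq g (isPElement_of_mem (Sylow.isPGroup' _) hg))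

theorem normal_of_isPElement_conj_mem (S : Sylow p G) {N : Subgroup G}
    (hS : ∀ g ∈ S, ∀ x ∈ N, g * x * g⁻¹ ∈ N)
    (h : ∀ q : ℕ, q.Prime → q ≠ p → ∀ g : G, IsPElement q g → ∀ x ∈ N, g * x * g⁻¹ ∈ N) :
    N.Normal := by
  refine normal_of_forall_exists_sylow_le_normalizer fun q hq ↦ ?_
  obtain rfl | hqp := eq_or_ne q p
  · exact ⟨S, hS⟩
  · exact ⟨Classical.arbitrary _, fun g hg ↦
      h q hq hqp g (isPElement_of_mem (Sylow.isPGroup' _) hg)⟩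

theorem sylow_sup_normal_of_commutator_mem (S : Sylow p G) (M : Subgroup G) [hM : M.Normal]
    (h : ∀ q : ℕ, q.Prime → q ≠ p → ∀ y : G, IsPElement q y → ∀ s ∈ S, ⁅y, s⁆ ∈ M) :
    ((S : Subgroup G) ⊔ M).Normal := by
  refine normal_of_isPElement_conj_mem S (fun g hg x hx ↦ ?_) fun q hq hqp g hg x hx ↦ ?_
  · have hg' : g ∈ (S : Subgroup G) ⊔ M := Subgroup.mem_sup_left hg
    exact mul_mem (mul_mem hg' hx) (inv_mem hg')
  · obtain ⟨s, hs, m, hm, rfl⟩ := Subgroup.mem_sup_of_normal_right.1 hx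
    rw [show g * (s * m) * g⁻¹ = ⁅g, s⁆ * s * (g * m * g⁻¹) by simp [commutatorElement_def]]
    exact mul_mem (mul_mem (Subgroup.mem_sup_right (h q hq hqp g hg s hs))
      (Subgroup.mem_sup_left hs)) (Subgroup.mem_sup_right (hM.conj_mem m hm g))

theorem isNilpotent_quotient_of_commutator_mem {M : Subgroup G} [M.Normal]
    (h : ∀ q r : ℕ, q.Prime → r.Prime → q ≠ p → q ≠ r → ∀ x y : G, IsPElement q x →
      IsPElement r y → ⁅x, y⁆ ∈ M) : Group.IsNilpotent (G ⧸ M) := by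
  refine (Group.isNilpotent_of_finite_tfae (G := G ⧸ M)).out 0 3 rfl rfl |>.2 fun r hr P ↦ ?_
  obtain ⟨S, rfl⟩ := Sylow.mapSurjective_surjective (QuotientGroup.mk'_surjective M) r P
  have hn := sylow_sup_normal_of_commutator_mem S M fun q hq hqr y hy s hs ↦ by
    have hs' := isPElement_of_mem S.isPGroup' hs
    obtain rfl | hqp := eq_or_ne q p
    · exact commutatorElement_inv s y ▸ inv_mem (h r q hr.out hq hqr.symm hqr.symm s y hs' hy)
    · exact h q r hq hr.out hqp hqr y s hy hs'
  have := hn.map _ (QuotientGroup.mk'_surjective M)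
  rwa [Subgroup.map_sup, QuotientGroup.map_mk'_self, sup_bot_eq] at this

theorem exists_normal_complement_of_isNilpotent [Group.IsNilpotent G] (hp : p.Prime) :
    ∃ D : Subgroup G, D.Normal ∧ ¬ p ∣ Nat.card D ∧ ∀ x : G, (orderOf x).Coprime p → x ∈ D := by
  have := Fact.mk hp
  let P : Sylow p G := Classical.arbitrary _
  have hPn : (P : Subgroup G).Normal :=
    (Group.isNilpotent_of_finite_tfae (G := G)).out 0 3 rfl rfl |>.1 inferInstance p ⟨hp⟩ P
  obtain ⟨D, hD⟩ := Subgroup.exists_right_complement'_of_coprime P.card_coprime_index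
  have hpD : ¬ p ∣ Nat.card D := hD.symm.index_eq_card ▸ P.not_dvd_index
  have hDP : D ≤ centralizer (P : Set G) := by
    refine le_of_forall_isPElement_mem fun r hr d hd hrd ↦ ?_
    obtain rfl | hrp := eq_or_ne r p
    · exact hrd.eq_one_of_mem hr hd hpD ▸ one_mem _
    · exact Subgroup.mem_centralizer_iff.2 fun a ha ↦
        commute_of_isNilpotent hp hr hrp.symm (isPElement_of_mem P.isPGroup' ha) hrd
  have hDn : D.Normal := by
    rw [← Subgroup.normalizer_eq_top_iff, eq_top_iff, ← hD.sup_eq_top]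
    exact sup_le ((Subgroup.le_centralizer_iff.1 hDP).trans (Subgroup.centralizer_le_normalizer _))
      Subgroup.le_normalizer
  refine ⟨D, hDn, hpD, fun x hx ↦ ?_⟩
  have hindex : (orderOf x).Coprime D.index := by
    obtain ⟨n, hn⟩ := IsPGroup.iff_card.1 P.isPGroup'
    rw [hD.index_eq_card, hn]
    exact hx.pow_right n
  exact mem_of_pow_mem_of_coprime hindex (pow_orderOf_eq_one x ▸ one_mem D) (D.pow_index_mem x)

end FiniteGroup

section Residuals

variable {G : Type*} [Group G] {p q r : ℕ} {x y : G}

theorem nilpotentResidual_le {N : Subgroup G} [hN : N.Normal] (h : Group.IsNilpotent (G ⧸ N)) :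
    nilpotentResidual G ≤ N :=
  sInf_le ⟨hN, h⟩

instance nilpotentResidual_normal : (nilpotentResidual G).Normal :=
  ⟨fun x hx g ↦ Subgroup.mem_sInf.2 fun N hN ↦ hN.1.conj_mem x (Subgroup.mem_sInf.1 hx N hN) g⟩

instance pCore_normal : (pCore G p).Normal :=
  Subgroup.sSup_normal _ fun _ h ↦ h.1

theorem le_pCore {N : Subgroup G} [hN : N.Normal] (h : IsPGroup p N) : N ≤ pCore G p :=
  le_sSup ⟨hN, h⟩

theorem pCore_le_sylow (S : Sylow p G) : pCore G p ≤ S :=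
  sSup_le fun _ h ↦ have := h.1; h.2.le_sylow_of_normal S

theorem isPGroup_pCore : IsPGroup p (pCore G p) :=
  (Classical.arbitrary (Sylow p G)).isPGroup'.to_le (pCore_le_sylow _)

theorem mem_pCore_of_isNilpotent [Finite G] (hp : p.Prime) {D : Subgroup G} [D.Normal]
    (hD : Group.IsNilpotent D) (hx : IsPElement p x) (hxD : x ∈ D) : x ∈ pCore G p := by
  have := Fact.mk hp
  obtain ⟨P, hP⟩ : ∃ P : Sylow p D, (⟨x, hxD⟩ : D) ∈ P :=
    IsPElement.exists_mem_sylow (hx.imp fun _ hk ↦ Subtype.ext hk)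
  have hPn : (P : Subgroup D).Normal :=
    (Group.isNilpotent_of_finite_tfae (G := D)).out 0 3 rfl rfl |>.1 hD p ⟨hp⟩ P
  have hPc : (P : Subgroup D).Characteristic := P.characteristic_of_normal hPn
  exact le_pCore (P.isPGroup'.map D.subtype) ⟨⟨x, hxD⟩, hP, rfl⟩

theorem commutator_mem_nilpotentResidual [Finite G] (hp : p.Prime) (hq : q.Prime) (hpq : p ≠ q)
    (hx : IsPElement p x) (hy : IsPElement q y) : ⁅x, y⁆ ∈ nilpotentResidual G := by
  refine Subgroup.mem_sInf.2 fun N ⟨_, hN⟩ ↦ ?_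
  rw [← QuotientGroup.eq_one_iff, ← QuotientGroup.mk'_apply, map_commutatorElement,
    commutatorElement_eq_one_iff_commute]
  exact commute_of_isNilpotent hp hq hpq (hx.map _) (hy.map _)

instance isNilpotent_quotient_nilpotentResidual [Finite G] :
    Group.IsNilpotent (G ⧸ nilpotentResidual G) :=
  isNilpotent_quotient_of_commutator_mem (p := 0) fun _ _ hq hr _ hqr _ _ hx hy ↦
    commutator_mem_nilpotentResidual hq hr hqr hx hy

/-- The Hall subgroup of an abelian subgroup `A` formed by its elements of order prime to `p`. -/
def primeToPart (p : ℕ) (A : Subgroup G) [IsMulCommutative A] : Subgroup G where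
  carrier := {x | x ∈ A ∧ (orderOf x).Coprime p}
  one_mem' := ⟨one_mem A, by simp⟩
  mul_mem' := fun ⟨ha, ha'⟩ ⟨hb, hb'⟩ ↦
    ⟨mul_mem ha hb, (ha'.mul_left hb').coprime_dvd_left
      (Commute.orderOf_mul_dvd_mul_orderOf (setLike_mul_comm ha hb))⟩
  inv_mem' := fun ⟨ha, ha'⟩ ↦ ⟨inv_mem ha, by rwa [orderOf_inv]⟩

variable {A : Subgroup G} [IsMulCommutative A]

theorem primeToPart_le : primeToPart p A ≤ A := fun _ hx ↦ hx.1

instance primeToPart_normal [hA : A.Normal] : (primeToPart p A).Normal :=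
  ⟨fun x hx g ↦ ⟨hA.conj_mem x hx.1 g, by
    rw [← MulAut.conj_apply, MulEquiv.orderOf_eq]; exact hx.2⟩⟩

theorem IsPElement.eq_one_of_mem_primeToPart (hp : p.Prime) (hx : IsPElement p x)
    (h : x ∈ primeToPart p A) : x = 1 :=
  by_contra fun h1 ↦ (hp.coprime_iff_not_dvd.1 h.2.symm) (hx.dvd_orderOf hp h1)

theorem dvd_card_primeToPart [Finite G] (hp : p.Prime) (hr : r.Prime) (hrp : r ≠ p)
    (h : r ∣ Nat.card A) : r ∣ Nat.card (primeToPart p A) := by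
  have := Fact.mk hr
  obtain ⟨x, hx⟩ := exists_prime_orderOf_dvd_card' r h
  rw [← Subgroup.orderOf_coe] at hx
  have hmem : (x : G) ∈ primeToPart p A := ⟨x.2, hx ▸ (Nat.coprime_primes hr hp).2 hrp⟩
  exact hx ▸ Subgroup.orderOf_dvd_natCard _ hmem

/-- `O^p(G)`: the normal subgroup generated by the elements of order prime to `p`. -/
def pResidual (G : Type*) [Group G] (p : ℕ) : Subgroup G :=
  Subgroup.normalClosure {x | (orderOf x).Coprime p}

instance pResidual_normal : (pResidual G p).Normal := Subgroup.normalClosure_normal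

theorem mem_pResidual (hx : (orderOf x).Coprime p) : x ∈ pResidual G p :=
  Subgroup.subset_normalClosure hx

theorem not_dvd_card_pResidual [Finite G] (hp : p.Prime)
    (hpL : ¬ p ∣ Nat.card (nilpotentResidual G)) : ¬ p ∣ Nat.card (pResidual G p) := by
  obtain ⟨D, hDn, hpD, hD⟩ :=
    exists_normal_complement_of_isNilpotent (G := G ⧸ nilpotentResidual G) hp
  have hle : pResidual G p ≤ D.comap (QuotientGroup.mk' _) :=
    Subgroup.normalClosure_le_normal fun x hx ↦
      hD _ (Nat.Coprime.coprime_dvd_left (orderOf_map_dvd _ x) hx)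
  rw [not_dvd_card_iff_forall_isPElement hp] at hpL hpD ⊢
  exact fun x hx hpx ↦
    hpL x ((QuotientGroup.eq_one_iff x).1 (hpD _ (hle hx) (hpx.map (QuotientGroup.mk' _)))) hpx

end Residuals

section BTGroup

variable {G : Type*} [Group G] {p : ℕ} {x : G}

theorem IsSemipermutable.conj_mem {H N : Subgroup G} [hN : N.Normal] (hH : IsSemipermutable H)
    (hle : H ≤ N) (hx : (orderOf x).Coprime (Nat.card N)) {h : G} (hh : h ∈ H) :
    x * h * x⁻¹ ∈ H := by
  have hperm : Permutes H (zpowers x) := by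
    refine hH _ ?_
    rw [Nat.card_zpowers]
    exact (hx.coprime_dvd_right (Subgroup.card_dvd_of_le hle)).symm
  obtain ⟨h', hh', _, ⟨i, rfl⟩, he : h' * x ^ i = x * h⟩ :=
    permutes_iff_forall_mul_mem.1 hperm.symm x (Subgroup.mem_zpowers x) h hh
  have hconj : x * h * x⁻¹ = h' * x ^ (i - 1) := by rw [← he, zpow_sub_one, mul_assoc]
  have hxN : x ^ (i - 1) ∈ N := by
    have := mul_mem (inv_mem (hle hh')) (hN.conj_mem h (hle hh) x)
    rwa [hconj, inv_mul_cancel_left] at this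
  have h1 : x ^ (i - 1) = 1 := by
    have hd := orderOf_dvd_of_mem_zpowers (Subgroup.zpow_mem_zpowers x (i - 1))
    rw [← orderOf_eq_one_iff]
    exact Nat.eq_one_of_dvd_coprimes hx hd (N.orderOf_dvd_natCard hxN)
  rwa [hconj, h1, mul_one]

theorem IsBTGroup.isSemipermutable_of_le_normal (hG : IsBTGroup G) {H N : Subgroup G} [N.Normal]
    (hle : H ≤ N) (hdvd : ∀ r : ℕ, r.Prime → r ∣ Nat.card N → r ∣ Nat.card H) :
    IsSemipermutable H := by
  refine hG H N hle (fun X hX ↦ ?_) fun X _ ↦ permutes_of_normal_left N X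
  rw [Nat.card_congr (Subgroup.subgroupOfEquivOfLe hle).toEquiv] at hX
  have hX1 : X = ⊥ := by
    rw [← Subgroup.card_eq_one]
    by_contra hne
    obtain ⟨r, hr, hd⟩ := Nat.exists_prime_and_dvd hne
    exact Nat.not_coprime_of_dvd_of_dvd hr.one_lt
      (hdvd r hr (hd.trans X.card_subgroup_dvd_card)) hd hX
  exact hX1 ▸ permutes_of_normal_right _ _

variable [Finite G]

theorem IsBTGroup.conj_mem_zpowers (hG : IsBTGroup G) (hp : p.Prime) (hx : (orderOf x).Coprime p)
    {v : G} (hv : v ∈ pCore G p) : x * v * x⁻¹ ∈ zpowers v := by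
  obtain rfl | h1 := eq_or_ne v 1
  · simp
  have := Fact.mk hp
  obtain ⟨n, hn⟩ := IsPGroup.iff_card.1 (isPGroup_pCore (G := G) (p := p))
  have hsemi : IsSemipermutable (zpowers v) := by
    refine hG.isSemipermutable_of_le_normal (Subgroup.zpowers_le.2 hv) fun r hr hd ↦ ?_
    rw [(Nat.prime_dvd_prime_iff_eq hr hp).1 (hr.dvd_of_dvd_pow (hn ▸ hd))]
    exact (isPElement_of_mem isPGroup_pCore hv).dvd_natCard hp h1 (Subgroup.mem_zpowers v)
  exact hsemi.conj_mem (Subgroup.zpowers_le.2 hv) (hn ▸ hx.pow_right n) (Subgroup.mem_zpowers v)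

theorem IsBTGroup.exists_forall_conj_eq_zpow (hG : IsBTGroup G) (hp : p.Prime)
    (hx : (orderOf x).Coprime p) :
    ∃ n : ℤ, ∀ u ∈ pCore G p, orderOf u = p → x * u * x⁻¹ = u ^ n := by
  obtain hbot | hne := eq_or_ne (pCore G p) ⊥
  · refine ⟨1, fun u hu _ ↦ ?_⟩
    rw [hbot, Subgroup.mem_bot] at hu
    simp [hu]
  obtain ⟨z, hzV, hz, hzc⟩ := exists_orderOf_eq_and_forall_commute hp isPGroup_pCore hne
  obtain ⟨n, hn : z ^ n = x * z * x⁻¹⟩ := hG.conj_mem_zpowers hp hx hzV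
  exact ⟨n, fun u huV hu ↦ conj_eq_zpow_of_orderOf_eq hp hz hu (hzc u huV) hn.symm
    (hG.conj_mem_zpowers hp hx huV) (hG.conj_mem_zpowers hp hx (mul_mem hzV huV))⟩

/- `x` and its conjugate `y * x * y⁻¹` act on the elements of order `p` by the same exponent, so
their quotient `⁅x, y⁆` fixes them. -/
theorem IsBTGroup.commute_commutator_of_orderOf_eq (hG : IsBTGroup G) (hp : p.Prime)
    (hx : (orderOf x).Coprime p) (y : G) {u : G} (hu : u ∈ pCore G p) (hup : orderOf u = p) :
    Commute ⁅x, y⁆ u := by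
  obtain ⟨n, hn⟩ := hG.exists_forall_conj_eq_zpow hp hx
  have hconj : ∀ g : G, ∀ v ∈ pCore G p, orderOf v = p →
      g * v * g⁻¹ ∈ pCore G p ∧ orderOf (g * v * g⁻¹) = p := fun g v hv hvp ↦
    ⟨pCore_normal.conj_mem v hv g, hvp ▸ (MulAut.conj g).orderOf_eq v⟩
  have hsame : ∀ v ∈ pCore G p, orderOf v = p →
      y * x * y⁻¹ * v * (y * x * y⁻¹)⁻¹ = x * v * x⁻¹ := by
    intro v hv hvp
    obtain ⟨hv', hvp'⟩ := hconj y⁻¹ v hv hvp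
    calc y * x * y⁻¹ * v * (y * x * y⁻¹)⁻¹ = y * (x * (y⁻¹ * v * y⁻¹⁻¹) * x⁻¹) * y⁻¹ := by group
      _ = x * v * x⁻¹ := by rw [hn _ hv' hvp', hn v hv hvp, ← conj_zpow]; group
  obtain ⟨hu', hup'⟩ := hconj (y * x * y⁻¹)⁻¹ u hu hup
  refine mul_inv_eq_iff_eq_mul.1 ?_
  calc ⁅x, y⁆ * u * ⁅x, y⁆⁻¹
      = x * ((y * x * y⁻¹)⁻¹ * u * (y * x * y⁻¹)⁻¹⁻¹) * x⁻¹ := by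
        rw [commutatorElement_def]; group
    _ = u := by rw [← hsame _ hu' hup']; group

theorem IsBTGroup.commutator_mem_centralizer_pCore (hG : IsBTGroup G) (hp : p.Prime)
    (hx : (orderOf x).Coprime p) (y : G) : ⁅x, y⁆ ∈ centralizer (pCore G p : Set G) := by
  refine Subgroup.mem_centralizer_iff.2 fun v (hv : v ∈ pCore G p) ↦ ?_
  set z := y * x⁻¹ * y⁻¹ with hz
  have hzx : orderOf z = orderOf x :=
    ((MulAut.conj y).orderOf_eq x⁻¹).trans (orderOf_inv x)
  obtain ⟨a, ha : v ^ a = x * v * x⁻¹⟩ := hG.conj_mem_zpowers hp hx hv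
  obtain ⟨b, hb : v ^ b = z * v * z⁻¹⟩ := hG.conj_mem_zpowers hp (hzx ▸ hx) hv
  have hab : ⁅x, y⁆ * v * ⁅x, y⁆⁻¹ = v ^ (a * b) := by
    calc ⁅x, y⁆ * v * ⁅x, y⁆⁻¹ = x * (z * v * z⁻¹) * x⁻¹ := by
          rw [hz, commutatorElement_def]; group
      _ = v ^ (a * b) := by rw [← hb, ← conj_zpow, ← ha, ← zpow_mul]
  have hfix : v ^ a ^ orderOf x = v ∧ v ^ b ^ orderOf x = v := by
    constructor
    · rw [← conj_pow_eq_zpow_pow ha.symm, pow_orderOf_eq_one, one_mul, inv_one, mul_one]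
    · rw [← conj_pow_eq_zpow_pow hb.symm, ← hzx, pow_orderOf_eq_one, one_mul, inv_one, mul_one]
  have hpow : Commute (⁅x, y⁆ ^ orderOf x) v := by
    refine mul_inv_eq_iff_eq_mul.1 ?_
    rw [conj_pow_eq_zpow_pow hab, mul_pow, zpow_mul, hfix.1, hfix.2]
  exact (commute_of_forall_commute_prime_order hp (isPElement_of_mem isPGroup_pCore hv)
    (hab ▸ Subgroup.zpow_mem_zpowers v _) hx.symm hpow fun u hu hup ↦
      hG.commute_commutator_of_orderOf_eq hp hx y (Subgroup.zpowers_le.2 hv hu) hup).symm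

theorem IsBTGroup.nilpotentResidual_le_centralizer_pCore (hG : IsBTGroup G) (hp : p.Prime) :
    nilpotentResidual G ≤ centralizer (pCore G p : Set G) :=
  nilpotentResidual_le <| isNilpotent_quotient_of_commutator_mem (p := p)
    fun _ _ hq _ hqp _ _ y hx _ ↦ hG.commutator_mem_centralizer_pCore hp
      (hx.coprime_orderOf ((Nat.coprime_primes hq hp).2 hqp)) y

theorem IsBTGroup.le_centralizer_nilpotentResidual (hG : IsBTGroup G) {D : Subgroup G} [D.Normal]
    (hD : Group.IsNilpotent D) : D ≤ centralizer (nilpotentResidual G : Set G) :=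
  le_of_forall_isPElement_mem fun _ hp _ hd hpd ↦
    Subgroup.le_centralizer_iff.1 (hG.nilpotentResidual_le_centralizer_pCore hp)
      (mem_pCore_of_isNilpotent hp hD hpd hd)

theorem IsBTGroup.isMulCommutative_nilpotentResidual (hG : IsBTGroup G)
    (hs : Group.IsSolvable G) : IsMulCommutative (nilpotentResidual G) := by
  rw [← Subgroup.le_centralizer_iff_isMulCommutative]
  suffices key : ∀ D : Subgroup G, D.Normal → D ≤ nilpotentResidual G →
      D ≤ centralizer (nilpotentResidual G : Set G) from key _ inferInstance le_rfl
  intro D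
  induction D using WellFoundedLT.induction with
  | ind D ih =>
    intro hDn hDL
    obtain rfl | hD := eq_or_ne D ⊥
    · exact bot_le
    have hlt : ⁅D, D⁆ < D := Group.IsSolvable.commutator_lt_of_ne_bot hD
    refine hG.le_centralizer_nilpotentResidual (isNilpotent_of_commutator_le_centralizer ?_)
    exact (ih _ hlt inferInstance (hlt.le.trans hDL)).trans (Subgroup.centralizer_le hDL)

end BTGroup

section Structure

variable {G : Type*} [Group G] [Finite G] {p q r : ℕ} {x y t : G}

theorem eq_or_dvd_of_dvd_card_sup [Fact p.Prime] (hr : r.Prime) (S : Sylow p G) {M : Subgroup G}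
    [M.Normal] (h : r ∣ Nat.card ((S : Subgroup G) ⊔ M : Subgroup G)) :
    r = p ∨ r ∣ Nat.card M := by
  have hdvd := h.trans (permutes_of_normal_right (S : Subgroup G) M).card_sup_dvd
  refine (hr.dvd_mul.1 hdvd).imp_left fun hS ↦ ?_
  obtain ⟨n, hn⟩ := IsPGroup.iff_card.1 S.isPGroup'
  exact (Nat.prime_dvd_prime_iff_eq hr Fact.out).1 (hr.dvd_of_dvd_pow (hn ▸ hS))

theorem sylow_sup_nilpotentResidual_normal (hp : p.Prime) (S : Sylow p G) :
    ((S : Subgroup G) ⊔ nilpotentResidual G).Normal :=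
  sylow_sup_normal_of_commutator_mem S _ fun _ hq hqp _ hy _ hs ↦
    commutator_mem_nilpotentResidual hq hp hqp hy (isPElement_of_mem S.isPGroup' hs)

theorem IsBTGroup.isSemipermutable_zpowers_sup (hG : IsBTGroup G) (hp : p.Prime)
    (ht : IsPElement p t) (h1 : t ≠ 1) {R : Subgroup G} (hRL : R ≤ nilpotentResidual G)
    (hR : ∀ r : ℕ, r.Prime → r ≠ p → r ∣ Nat.card (nilpotentResidual G) → r ∣ Nat.card R) :
    IsSemipermutable (zpowers t ⊔ R) := by
  have := Fact.mk hp
  obtain ⟨S, htS⟩ := ht.exists_mem_sylow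
  have := sylow_sup_nilpotentResidual_normal hp S
  refine hG.isSemipermutable_of_le_normal (sup_le_sup (Subgroup.zpowers_le.2 htS) hRL)
    fun r hr hd ↦ ?_
  obtain rfl | hrp := eq_or_ne r p
  · exact ht.dvd_natCard hr h1 (Subgroup.mem_sup_left (Subgroup.mem_zpowers t))
  · exact (hR r hr hrp ((eq_or_dvd_of_dvd_card_sup hr S hd).resolve_left hrp)).trans
      (Subgroup.card_dvd_of_le le_sup_right)

variable [IsMulCommutative (nilpotentResidual G)]

theorem mem_pCore_of_mem_nilpotentResidual (hp : p.Prime) (hx : IsPElement p x)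
    (hxL : x ∈ nilpotentResidual G) : x ∈ pCore G p :=
  mem_pCore_of_isNilpotent hp (isNilpotent_of_commutator_le_centralizer
    ((Subgroup.commutator_le_self _).trans (Subgroup.le_centralizer _))) hx hxL

theorem commutator_mem_primeToPart_of_forall_commute (hp : p.Prime)
    (hq : q.Prime) (hr : r.Prime) (hqp : q ≠ p) (hqr : q ≠ r) (hx : IsPElement q x)
    (hy : IsPElement r y)
    (h : ∀ a ∈ nilpotentResidual G, IsPElement p a → Commute x a) :
    ⁅x, y⁆ ∈ primeToPart p (nilpotentResidual G) := by
  set R := primeToPart p (nilpotentResidual G)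
  have hcL := commutator_mem_nilpotentResidual hq hr hqr hx hy
  obtain ⟨i, m, hpm, hcard⟩ :=
    Nat.exists_eq_pow_mul_and_not_dvd (orderOf_pos ⁅x, y⁆).ne' p hp.ne_one
  have hm : p.Coprime m := hp.coprime_iff_not_dvd.2 hpm
  have hcp : ⁅x, y⁆ ^ p ^ i ∈ R := by
    refine ⟨pow_mem hcL _, hm.symm.coprime_dvd_left (orderOf_dvd_of_pow_eq_one ?_)⟩
    rw [← pow_mul, ← hcard, pow_orderOf_eq_one]
  have hcm : Commute (⁅x, y⁆ ^ m) x := by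
    refine (h _ (pow_mem hcL m) ⟨i, ?_⟩).symm
    rw [← pow_mul, mul_comm, ← hcard, pow_orderOf_eq_one]
  let π := QuotientGroup.mk' R
  have hcomm : Commute (π x) ⁅π x, π y⁆ := by
    refine (commute_of_pow_coprime (hm.pow_left i) ?_ ?_).symm
    · rw [← map_commutatorElement, ← map_pow, show π _ = 1 from (QuotientGroup.eq_one_iff _).2 hcp]
      exact Commute.one_left _
    · rw [← map_commutatorElement, ← map_pow]
      exact hcm.map π
  obtain ⟨k, hk⟩ := hx
  have hpq := (Nat.coprime_primes hp hq).2 hqp.symm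
  refine mem_of_pow_mem_of_coprime ((hpq.pow_left i).pow_right k) hcp ?_
  rw [← QuotientGroup.eq_one_iff, ← QuotientGroup.mk'_apply, map_pow, map_commutatorElement,
    commutatorElement_pow_of_commute hcomm, ← map_pow, hk, map_one, commutatorElement_one_left]

theorem exists_not_commute_of_dvd_card (hp : p.Prime) (hd : p ∣ Nat.card (nilpotentResidual G)) :
    ∃ q : ℕ, q.Prime ∧ q ≠ p ∧ ∃ x : G, IsPElement q x ∧
      ∃ a ∈ nilpotentResidual G, IsPElement p a ∧ ¬ Commute x a := by
  by_contra! hall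
  have hle : nilpotentResidual G ≤ primeToPart p (nilpotentResidual G) :=
    nilpotentResidual_le <| isNilpotent_quotient_of_commutator_mem (p := p)
      fun q r hq hr hqp hqr x y hx hy ↦ commutator_mem_primeToPart_of_forall_commute hp hq hr
        hqp hqr hx hy (hall q hq hqp x hx)
  exact (not_dvd_card_iff_forall_isPElement hp).2
    (fun x hx hpx ↦ hpx.eq_one_of_mem_primeToPart hp (hle hx)) hd

theorem IsBTGroup.commutator_mem_primeToPart (hG : IsBTGroup G) (hp : p.Prime) (hq : q.Prime)
    (hqp : q ≠ p) (hqL : ¬ q ∣ Nat.card (nilpotentResidual G)) (hx : IsPElement q x)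
    (ht : IsPElement p t) (htL : t ∉ nilpotentResidual G) :
    ⁅x, t⁆ ∈ primeToPart p (nilpotentResidual G) := by
  have := Fact.mk hp
  set R := primeToPart p (nilpotentResidual G)
  have ht1 : t ≠ 1 := fun h ↦ htL (h ▸ one_mem _)
  obtain ⟨S, htS⟩ := ht.exists_mem_sylow
  have := sylow_sup_nilpotentResidual_normal hp S
  have hmem : x * t * x⁻¹ ∈ zpowers t ⊔ R := by
    refine (hG.isSemipermutable_zpowers_sup hp ht ht1 primeToPart_le
      fun r hr ↦ dvd_card_primeToPart hp hr).conj_mem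
      (sup_le_sup (Subgroup.zpowers_le.2 htS) primeToPart_le) (hx.coprime_orderOf ?_)
      (Subgroup.mem_sup_left (Subgroup.mem_zpowers t))
    exact hq.coprime_iff_not_dvd.2 fun h ↦ (eq_or_dvd_of_dvd_card_sup hq S h).elim hqp hqL
  obtain ⟨_, ⟨n, rfl⟩, ρ, hρ, he : t ^ n * ρ = x * t * x⁻¹⟩ :=
    Subgroup.mem_sup_of_normal_right.1 hmem
  have hpn : (p : ℤ) ∣ n - 1 := by
    by_contra h
    refine htL (ht.mem_of_zpow_mem hp h ?_)
    have hconj := nilpotentResidual_normal.conj_mem _ (inv_mem hρ.1) t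
    have hcL := mul_mem (commutator_mem_nilpotentResidual hq hp hqp hx ht) hconj
    rwa [commutatorElement_def, ← he,
      show t ^ n * ρ * t⁻¹ * (t * ρ⁻¹ * t⁻¹) = t ^ (n - 1) by rw [zpow_sub_one]; group] at hcL
  let π := QuotientGroup.mk' R
  have hbar : π x * π t * (π x)⁻¹ = π t ^ n := by
    rw [← map_inv, ← map_mul, ← map_mul, ← he, map_mul, map_zpow,
      show π ρ = 1 from (QuotientGroup.eq_one_iff _).2 hρ, mul_one]
  have hcomm : Commute (π x) (π t) := by
    refine commute_of_conj_eq_zpow (ht.map π) hbar hpn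
      (hx.coprime_orderOf ((Nat.coprime_primes hq hp).2 hqp)).symm ?_
    rw [← map_pow, pow_orderOf_eq_one, map_one]
    exact Commute.one_left _
  rw [← QuotientGroup.eq_one_iff, ← QuotientGroup.mk'_apply, map_commutatorElement]
  exact commutatorElement_eq_one_iff_commute.2 hcomm

/- The prime `q` of an element moving the `p`-part of `L` divides `p - 1`, so that by induction
`q ∤ |L|`. -/
theorem IsBTGroup.mem_nilpotentResidual_of_dvd (hG : IsBTGroup G) (hp : p.Prime)
    (hd : p ∣ Nat.card (nilpotentResidual G)) (hy : IsPElement p y) :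
    y ∈ nilpotentResidual G := by
  induction p using Nat.strong_induction_on generalizing y with
  | _ p ih =>
    obtain ⟨q, hq, hqp, x, hx, a, haL, ha, hxa⟩ := exists_not_commute_of_dvd_card hp hd
    have haV := mem_pCore_of_mem_nilpotentResidual hp ha haL
    have hxz : x * a * x⁻¹ ∈ zpowers a :=
      hG.conj_mem_zpowers hp (hx.coprime_orderOf ((Nat.coprime_primes hq hp).2 hqp)) haV
    have hqL : ¬ q ∣ Nat.card (nilpotentResidual G) := by
      intro hqL
      have hqp1 := dvd_sub_one_of_not_commute hp hq hqp.symm hx ha hxz hxa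
      have hlt : q < p :=
        Nat.lt_of_le_pred hp.pos (Nat.le_of_dvd (Nat.sub_pos_of_lt hp.one_lt) hqp1)
      exact hxa (setLike_mul_comm (ih q hlt hq hqL hx) haL)
    by_contra hyL
    obtain ⟨S, hyS⟩ := hy.exists_mem_sylow
    have hyaL : y * a ∉ nilpotentResidual G := fun h ↦
      hyL ((Subgroup.mul_mem_cancel_right _ haL).1 h)
    have hya : IsPElement p (y * a) :=
      isPElement_of_mem S.isPGroup' (mul_mem hyS (pCore_le_sylow S haV))
    have hxa1 : ⁅x, a⁆ ∈ primeToPart p (nilpotentResidual G) := by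
      have hyR := hG.commutator_mem_primeToPart hp hq hqp hqL hx hy hyL
      have hyaR := hG.commutator_mem_primeToPart hp hq hqp hqL hx hya hyaL
      have := primeToPart_normal.conj_mem _ (mul_mem (inv_mem hyR) hyaR) y⁻¹
      rwa [show y⁻¹ * (⁅x, y⁆⁻¹ * ⁅x, y * a⁆) * y⁻¹⁻¹ = ⁅x, a⁆ by
        simp only [commutatorElement_def]; group] at this
    refine hxa (commutatorElement_eq_one_iff_commute.1 ?_)
    refine IsPElement.eq_one_of_mem_primeToPart hp ?_ hxa1
    exact isPElement_of_mem ha.isPGroup_zpowers (mul_mem hxz (inv_mem (Subgroup.mem_zpowers a)))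

theorem IsBTGroup.normal_of_le_nilpotentResidual (hG : IsBTGroup G) {H : Subgroup G}
    (hH : H ≤ nilpotentResidual G) : H.Normal := by
  refine normal_of_forall_isPElement_conj_mem fun q hq g hg p hp t ht hpt ↦ ?_
  obtain rfl | hqp := eq_or_ne q p
  · obtain rfl | h1 := eq_or_ne t 1
    · simp
    have hgL := hG.mem_nilpotentResidual_of_dvd hq (hpt.dvd_natCard hq h1 (hH ht)) hg
    rwa [setLike_mul_comm hgL (hH ht), mul_inv_cancel_right]
  · exact Subgroup.zpowers_le.2 ht (hG.conj_mem_zpowers hp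
      (hg.coprime_orderOf ((Nat.coprime_primes hq hp).2 hqp))
      (mem_pCore_of_mem_nilpotentResidual hp hpt (hH ht)))

theorem IsBTGroup.isSemipermutable_zpowers (hG : IsBTGroup G) (hp : p.Prime)
    (hx : IsPElement p x) : IsSemipermutable (zpowers x) := by
  obtain rfl | h1 := eq_or_ne x 1
  · exact fun X _ ↦ Subgroup.zpowers_one_eq_bot (G := G) ▸ permutes_of_normal_left ⊥ X
  refine hG _ (zpowers x ⊔ nilpotentResidual G) le_sup_left (fun X hX ↦ ?_)
    (hG.isSemipermutable_zpowers_sup hp hx h1 le_rfl fun _ _ _ h ↦ h)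
  rw [Nat.card_congr (Subgroup.subgroupOfEquivOfLe le_sup_left).toEquiv] at hX
  have hXL : X.map (Subgroup.subtype _) ≤ nilpotentResidual G := by
    rintro _ ⟨e, he, rfl⟩
    refine mem_of_mem_sup_of_coprime e.2 (Nat.Coprime.coprime_dvd_left ?_ hX.symm)
    rw [Subgroup.coe_subtype, Subgroup.orderOf_coe]
    exact X.orderOf_dvd_natCard he
  have hXn := (hG.normal_of_le_nilpotentResidual hXL).comap
    (zpowers x ⊔ nilpotentResidual G).subtype
  rw [Subgroup.comap_map_eq_self_of_injective (Subgroup.subtype_injective _)] at hXn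
  exact permutes_of_normal_right _ _

theorem IsBTGroup.commute_of_not_dvd (hG : IsBTGroup G) (hp : p.Prime) (hq : q.Prime)
    (hpq : p ≠ q) (hpL : ¬ p ∣ Nat.card (nilpotentResidual G))
    (hqL : ¬ q ∣ Nat.card (nilpotentResidual G)) (hx : IsPElement p x) (hy : IsPElement q y) :
    Commute x y := by
  have hperm : Permutes (zpowers x) (zpowers y) := by
    refine hG.isSemipermutable_zpowers hp hx _ ?_
    rw [Nat.card_zpowers, Nat.card_zpowers]
    exact hx.coprime_orderOf (hy.coprime_orderOf ((Nat.coprime_primes hq hp).2 hpq.symm)).symm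
  have hcop : (Nat.card (zpowers x ⊔ zpowers y : Subgroup G)).Coprime
      (Nat.card (nilpotentResidual G)) := by
    refine Nat.Coprime.coprime_dvd_left hperm.card_sup_dvd ?_
    rw [Nat.card_zpowers, Nat.card_zpowers]
    exact (hx.coprime_orderOf (hp.coprime_iff_not_dvd.2 hpL)).mul_left
      (hy.coprime_orderOf (hq.coprime_iff_not_dvd.2 hqL))
  refine commutatorElement_eq_one_iff_commute.1 <|
    Subgroup.disjoint_def.1 (Subgroup.disjoint_of_coprime_natCard hcop) ?_
      (commutator_mem_nilpotentResidual hp hq hpq hx hy)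
  exact Subgroup.commutator_le_self _ <| Subgroup.commutator_mem_commutator
    (Subgroup.mem_sup_left (Subgroup.mem_zpowers x))
    (Subgroup.mem_sup_right (Subgroup.mem_zpowers y))

theorem IsBTGroup.permutes_of_isPGroup_of_ne (hG : IsBTGroup G) (hp : p.Prime) (hq : q.Prime)
    (hpq : p ≠ q) {P Q : Subgroup G} (hP : IsPGroup p P) (hQ : IsPGroup q Q) : Permutes P Q := by
  by_cases hpL : p ∣ Nat.card (nilpotentResidual G)
  · have := hG.normal_of_le_nilpotentResidual fun x hx ↦
      hG.mem_nilpotentResidual_of_dvd hp hpL (isPElement_of_mem hP hx)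
    exact permutes_of_normal_left P Q
  by_cases hqL : q ∣ Nat.card (nilpotentResidual G)
  · have := hG.normal_of_le_nilpotentResidual fun x hx ↦
      hG.mem_nilpotentResidual_of_dvd hq hqL (isPElement_of_mem hQ hx)
    exact permutes_of_normal_right P Q
  exact permutes_of_commute fun x hx y hy ↦ hG.commute_of_not_dvd hp hq hpq hpL hqL
    (isPElement_of_mem hP hx) (isPElement_of_mem hQ hy)

/- Power automorphisms of an abelian group commute. -/
theorem IsBTGroup.commutator_mem_centralizer_nilpotentResidual (hG : IsBTGroup G) (g h : G) :
    ⁅g, h⁆ ∈ centralizer (nilpotentResidual G : Set G) := by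
  refine Subgroup.mem_centralizer_iff.2 fun l hl ↦ ?_
  set t := (h * g)⁻¹ * l * (h * g) with ht
  have htL : t ∈ nilpotentResidual G := by
    simpa [ht] using nilpotentResidual_normal.conj_mem l hl (h * g)⁻¹
  have hn := hG.normal_of_le_nilpotentResidual (Subgroup.zpowers_le.2 htL)
  obtain ⟨a, ha : t ^ a = g * t * g⁻¹⟩ := hn.conj_mem t (Subgroup.mem_zpowers t) g
  obtain ⟨b, hb : t ^ b = h * t * h⁻¹⟩ := hn.conj_mem t (Subgroup.mem_zpowers t) h
  have hcomm : g * h * t * (g * h)⁻¹ = l := by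
    calc g * h * t * (g * h)⁻¹ = g * (h * t * h⁻¹) * g⁻¹ := by group
      _ = h * (g * t * g⁻¹) * h⁻¹ := by
        rw [← ha, ← hb, ← conj_zpow, ← ha, ← conj_zpow, ← hb, ← zpow_mul, ← zpow_mul, mul_comm]
      _ = l := by rw [ht]; group
  calc l * ⁅g, h⁆ = g * h * t * (g * h)⁻¹ * ⁅g, h⁆ := by rw [hcomm]
    _ = ⁅g, h⁆ * l := by rw [ht, commutatorElement_def]; group

theorem IsBTGroup.sylow_inf_centralizer_normal (hG : IsBTGroup G) (hp : p.Prime)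
    (hpL : ¬ p ∣ Nat.card (nilpotentResidual G)) (S : Sylow p G) :
    ((S : Subgroup G) ⊓ centralizer (nilpotentResidual G : Set G)).Normal := by
  have hC : (centralizer (nilpotentResidual G : Set G)).Normal := inferInstance
  refine normal_of_isPElement_conj_mem S (fun g hg x hx ↦ ?_) fun q hq hqp g hg x hx ↦ ?_
  · exact ⟨(Subgroup.mem_normalizer_iff.1 (Subgroup.le_normalizer hg) x).1 hx.1,
      hC.conj_mem x hx.2 g⟩
  · suffices hgx : Commute g x by rwa [hgx.eq, mul_inv_cancel_right]
    by_cases hqL : q ∣ Nat.card (nilpotentResidual G)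
    · exact Subgroup.mem_centralizer_iff.1 hx.2 g (hG.mem_nilpotentResidual_of_dvd hq hqL hg)
    · exact hG.commute_of_not_dvd hq hp hqp hqL hpL hg (isPElement_of_mem S.isPGroup' hx.1)

theorem IsBTGroup.mem_pCore_iff_mem_centralizer (hG : IsBTGroup G) (hp : p.Prime)
    (hpL : ¬ p ∣ Nat.card (nilpotentResidual G)) (hx : IsPElement p x) :
    x ∈ pCore G p ↔ x ∈ centralizer (nilpotentResidual G : Set G) := by
  refine ⟨fun h ↦ Subgroup.le_centralizer_iff.1 (hG.nilpotentResidual_le_centralizer_pCore hp) h,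
    fun hxC ↦ ?_⟩
  obtain ⟨S, hxS⟩ := hx.exists_mem_sylow
  have := hG.sylow_inf_centralizer_normal hp hpL S
  exact le_pCore S.isPGroup'.to_inf_left ⟨hxS, hxC⟩

end Structure

section SSPermutable

theorem commutator_le_iff_le_comap_centralizer {G : Type*} [Group G] {H K N : Subgroup G}
    [N.Normal] : ⁅H, K⁆ ≤ N ↔
      K ≤ (centralizer (H.map (QuotientGroup.mk' N))).comap (QuotientGroup.mk' N) := by
  rw [Subgroup.commutator_comm, ← Subgroup.map_le_iff_le_comap,
    ← Subgroup.commutator_eq_bot_iff_le_centralizer, ← Subgroup.map_commutator,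
    Subgroup.map_eq_bot_iff, QuotientGroup.ker_mk']

theorem commutator_iSup_le {G ι : Type*} [Group G] {H N : Subgroup G} [N.Normal]
    {K : ι → Subgroup G} (h : ∀ i, ⁅H, K i⁆ ≤ N) : ⁅H, ⨆ i, K i⁆ ≤ N :=
  commutator_le_iff_le_comap_centralizer.2 <|
    iSup_le fun i ↦ commutator_le_iff_le_comap_centralizer.1 (h i)

variable {G : Type*} [Group G] {p : ℕ} {H P K N : Subgroup G}

theorem elemCommutator_le_commutator (x : G) : elemCommutator x H ≤ ⁅zpowers x, H⁆ := by
  refine (Subgroup.closure_le _).2 ?_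
  rintro _ ⟨h, hh, rfl⟩
  simpa [commutatorElement_def] using
    Subgroup.commutator_mem_commutator (inv_mem (Subgroup.mem_zpowers x)) (inv_mem hh)

theorem IsSupplement.le_of_coprime [N.Normal] (h : IsSupplement H K)
    (hcop : (Nat.card H).Coprime (Nat.card N)) : N ≤ K := by
  have hdvd : K.relIndex N ∣ Nat.card H :=
    calc K.relIndex N = K.relIndex (N ⊔ K) := (permutes_of_normal_left N K).relIndex_sup.symm
      _ ∣ K.index := Subgroup.relIndex_dvd_index_of_le le_sup_right
      _ = K.relIndex H := h.index_eq
      _ ∣ Nat.card H := Subgroup.relIndex_dvd_card K H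
  exact Subgroup.relIndex_eq_one.1
    (Nat.eq_one_of_dvd_coprimes hcop hdvd (Subgroup.relIndex_dvd_card K N))

theorem isSupplement_of_sup_eq_top [K.Normal] (h : H ⊔ K = ⊤) : IsSupplement H K := by
  rw [IsSupplement, ← Subgroup.mul_normal, h, Subgroup.coe_top]

variable [Finite G]

theorem IsSupplement.isSylowProduct [Fact p.Prime] (h : IsSupplement P K) (hP : IsPGroup p P)
    (Q : Sylow p K) (hQ : Permutes P ((Q : Subgroup K).map K.subtype)) :
    IsSylowProduct p P ((Q : Subgroup K).map K.subtype) := by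
  set T := P ⊔ (Q : Subgroup K).map K.subtype
  have hTp : IsPGroup p T := hQ.isPGroup_sup hP (Q.isPGroup'.map _)
  have hdvd : T.index ∣ (Q : Subgroup K).index :=
    calc T.index = T.relIndex K := (h.mono le_sup_left).symm.index_eq
      _ ∣ ((Q : Subgroup K).map K.subtype).relIndex K :=
        Subgroup.relIndex_dvd_of_le_left K le_sup_right
      _ = (Q : Subgroup K).index := by
        rw [Subgroup.relIndex, Subgroup.subgroupOf,
          Subgroup.comap_map_eq_self_of_injective (Subgroup.subtype_injective _)]
  exact ⟨hTp.toSylow fun hd ↦ Q.not_dvd_index (hd.trans hdvd), hQ.coe_sup⟩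

theorem isSSPermutable_of_isNilpotent [Group.IsNilpotent G] (H : Subgroup G) :
    IsSSPermutable H := by
  refine ⟨⊤, isSupplement_of_sup_eq_top (sup_top_eq H), fun p hp Q ↦ ?_⟩
  have hQ : (Q : Subgroup (⊤ : Subgroup G)).Normal :=
    (Group.isNilpotent_of_finite_tfae (G := (⊤ : Subgroup G))).out 0 3 rfl rfl |>.1
      inferInstance p ⟨hp⟩ Q
  have := hQ.map (Subgroup.subtype ⊤) fun g ↦ ⟨⟨g, Subgroup.mem_top g⟩, rfl⟩
  exact permutes_of_normal_right _ _

theorem sylow_sup_pResidual (hp : p.Prime) (S : Sylow p G) :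
    (S : Subgroup G) ⊔ pResidual G p = ⊤ := by
  refine eq_top_of_forall_sylow_le fun r hr ↦ ?_
  obtain rfl | hrp := eq_or_ne r p
  · exact ⟨S, le_sup_left⟩
  · exact ⟨Classical.arbitrary _, fun x hx ↦ Subgroup.mem_sup_right <| mem_pResidual <|
      (isPElement_of_mem (Sylow.isPGroup' _) hx).coprime_orderOf
        ((Nat.coprime_primes hr hp).2 hrp)⟩

variable [IsMulCommutative (nilpotentResidual G)]

theorem IsBTGroup.isSSPermutable_sylow (hG : IsBTGroup G) (hp : p.Prime)
    (hpL : ¬ p ∣ Nat.card (nilpotentResidual G)) (S : Sylow p G) :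
    IsSSPermutable (S : Subgroup G) := by
  refine ⟨pResidual G p, isSupplement_of_sup_eq_top (sylow_sup_pResidual hp S), fun r hr Q ↦ ?_⟩
  have hQ : IsPGroup r ((Q : Subgroup (pResidual G p)).map (pResidual G p).subtype) :=
    Q.isPGroup'.map _
  obtain rfl | hrp := eq_or_ne p r
  · refine permutes_of_commute fun x _ y hy ↦ ?_
    rw [(isPElement_of_mem hQ hy).eq_one_of_mem hp (Subgroup.map_subtype_le _ hy)
      (not_dvd_card_pResidual hp hpL)]
    exact Commute.one_right x
  · exact hG.permutes_of_isPGroup_of_ne hp hr hrp S.isPGroup' hQ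

theorem IsBTGroup.isSSPermutable_of_isPGroup (hG : IsBTGroup G) (hT : IsSSTGroup G) (hp : p.Prime)
    (hpL : ¬ p ∣ Nat.card (nilpotentResidual G)) (hP : IsPGroup p P) : IsSSPermutable P := by
  have := Fact.mk hp
  obtain ⟨S, hS⟩ := hP.exists_le_sylow
  have : Group.IsNilpotent (S : Subgroup G) := S.isPGroup'.isNilpotent
  exact hT P S hS (isSSPermutable_of_isNilpotent _) (hG.isSSPermutable_sylow hp hpL S)

theorem IsBTGroup.commutator_le_pCore_of_permutes (hG : IsBTGroup G) (hp : p.Prime)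
    (hpL : ¬ p ∣ Nat.card (nilpotentResidual G)) (hP : IsPGroup p P) (hK : IsPGroup p K)
    (h : Permutes P K) : ⁅P, K⁆ ≤ pCore G p := by
  have := Fact.mk hp
  refine Subgroup.commutator_le.2 fun x hx y hy ↦ ?_
  refine (hG.mem_pCore_iff_mem_centralizer hp hpL ?_).2
    (hG.commutator_mem_centralizer_nilpotentResidual x y)
  exact isPElement_of_mem (h.isPGroup_sup hP hK) <| Subgroup.commutator_le_self _ <|
    Subgroup.commutator_mem_commutator (Subgroup.mem_sup_left hx) (Subgroup.mem_sup_right hy)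

theorem IsBTGroup.exists_isSylowProduct_of_isSSPermutable (hG : IsBTGroup G) (hp : p.Prime)
    (hpL : ¬ p ∣ Nat.card (nilpotentResidual G)) (hP : IsPGroup p P) (hSS : IsSSPermutable P) :
    ∃ K : Subgroup G, IsPGroup p K ∧ IsSylowProduct p P K ∧
      ⁅P, conjClosure K (nilpotentResidual G)⁆ ≤ pCore G p := by
  have := Fact.mk hp
  obtain ⟨K, hsup, hperm⟩ := hSS
  have hLK : nilpotentResidual G ≤ K := by
    obtain ⟨n, hn⟩ := IsPGroup.iff_card.1 hP
    exact hsup.le_of_coprime (hn ▸ (hp.coprime_iff_not_dvd.2 hpL).pow_left n)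
  let Q : Sylow p K := Classical.arbitrary _
  refine ⟨(Q : Subgroup K).map K.subtype, Q.isPGroup'.map _,
    hsup.isSylowProduct hP Q (hperm p hp Q), commutator_iSup_le fun l ↦ ?_⟩
  let k : K := ⟨l, hLK l.2⟩
  have hconj : ((Q : Subgroup K).map K.subtype).map (MulAut.conj (l : G)).toMonoidHom =
      ((k • Q : Sylow p K) : Subgroup K).map K.subtype := by
    change _ = ((Q : Subgroup K).map (MulAut.conj k).toMonoidHom).map K.subtype
    rw [Subgroup.map_map, Subgroup.map_map]
    rfl
  rw [hconj]
  exact hG.commutator_le_pCore_of_permutes hp hpL hP ((k • Q).isPGroup'.map _) (hperm p hp _)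

end SSPermutable

section CentralizingCofactor

variable {G : Type*} [Group G] {p : ℕ} {x s t l l₀ : G}

theorem commutator_mem_conjClosure {K L : Subgroup G} (hx : x ∈ K) (hl : l ∈ L) :
    ⁅x, l⁆ ∈ conjClosure K L := by
  have hconj : ∀ y ∈ K, ∀ m ∈ L, m * y * m⁻¹ ∈ conjClosure K L := fun y hy m hm ↦
    le_iSup (fun l : L ↦ K.map (MulAut.conj (l : G)).toMonoidHom) ⟨m, hm⟩ ⟨y, hy, rfl⟩
  have := mul_mem (hconj x hx 1 (one_mem L)) (hconj x⁻¹ (inv_mem hx) l hl)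
  rwa [show 1 * x * 1⁻¹ * (l * x⁻¹ * l⁻¹) = ⁅x, l⁆ by
    rw [commutatorElement_def]; group] at this

/-- The requirement on a `p`-element `x` in statement (3) of the theorem. -/
def HasCentralizingCofactor (p : ℕ) (x : G) : Prop :=
  ∃ K : Subgroup G, IsPGroup p K ∧ IsSylowProduct p (zpowers x) K ∧
    elemCommutator x (conjClosure K (nilpotentResidual G)) ≤ pCore G p

theorem commute_of_elemCommutator_le_pCore (hp : p.Prime)
    (hpL : ¬ p ∣ Nat.card (nilpotentResidual G)) {H : Subgroup G}
    (h : elemCommutator x H ≤ pCore G p) (hl : l ∈ nilpotentResidual G) (hlH : l ∈ H) :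
    Commute x l := by
  have hcore : x⁻¹ * l⁻¹ * x * l ∈ pCore G p := h (Subgroup.subset_closure ⟨l, hlH, rfl⟩)
  have hL : x⁻¹ * l⁻¹ * x * l ∈ nilpotentResidual G := by
    simpa using mul_mem (nilpotentResidual_normal.conj_mem _ (inv_mem hl) x⁻¹) hl
  have h1 := (isPElement_of_mem isPGroup_pCore hcore).eq_one_of_mem hp hL hpL
  rw [show x⁻¹ * l⁻¹ * x * l = (l * x)⁻¹ * (x * l) by group, inv_mul_eq_one] at h1
  exact h1.symm

variable [Finite G] [IsMulCommutative (nilpotentResidual G)]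

theorem IsBTGroup.mem_pCore_of_forall_commute (hG : IsBTGroup G) (hp : p.Prime)
    (hpL : ¬ p ∣ Nat.card (nilpotentResidual G)) (hx : IsPElement p x)
    (h : ∀ l ∈ nilpotentResidual G, (orderOf l).Prime → Commute x l) : x ∈ pCore G p := by
  suffices hle : nilpotentResidual G ≤ centralizer {x} from
    (hG.mem_pCore_iff_mem_centralizer hp hpL hx).2 <| Subgroup.mem_centralizer_iff.2 fun l hl ↦
      (Subgroup.mem_centralizer_iff.1 (hle hl) x rfl).symm
  refine le_of_forall_isPElement_mem fun r hr l hl hlr ↦ ?_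
  rw [Subgroup.mem_centralizer_singleton_iff]
  obtain rfl | hl1 := eq_or_ne l 1
  · simp
  have hrp : r ≠ p := fun hrp ↦ hpL (hrp ▸ hlr.dvd_natCard hr hl1 hl)
  have hn := hG.normal_of_le_nilpotentResidual (Subgroup.zpowers_le.2 hl)
  refine (commute_of_forall_commute_prime_order hr hlr (hn.conj_mem l (Subgroup.mem_zpowers l) x)
    (hx.coprime_orderOf ((Nat.coprime_primes hp hr).2 hrp.symm)).symm ?_ fun u hu hur ↦
      h u (Subgroup.zpowers_le.2 hl hu) (hur ▸ hr)).symm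
  rw [pow_orderOf_eq_one]
  exact Commute.one_left l

theorem IsBTGroup.commute_of_not_commute (hG : IsBTGroup G) (hp : p.Prime)
    (hpL : ¬ p ∣ Nat.card (nilpotentResidual G)) {K : Subgroup G}
    (h : elemCommutator x (conjClosure K (nilpotentResidual G)) ≤ pCore G p) (ht : t ∈ K)
    (hl : l ∈ nilpotentResidual G) (hlp : (orderOf l).Prime) (hxl : ¬ Commute x l) :
    Commute t l := by
  have hn := hG.normal_of_le_nilpotentResidual (Subgroup.zpowers_le.2 hl)
  obtain ⟨n, hn : l ^ n = ⁅t, l⁆⟩ : ⁅t, l⁆ ∈ zpowers l :=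
    mul_mem (hn.conj_mem l (Subgroup.mem_zpowers l) t) (inv_mem (Subgroup.mem_zpowers l))
  have hxc : Commute x (l ^ n) := commute_of_elemCommutator_le_pCore hp hpL h (zpow_mem hl n)
    (hn ▸ commutator_mem_conjClosure ht hl)
  have hdvd : (orderOf l : ℤ) ∣ n := by
    by_contra hd
    have hlP : IsPElement (orderOf l) l := ⟨1, by rw [pow_one, pow_orderOf_eq_one]⟩
    exact hxl (Subgroup.mem_centralizer_singleton_iff.1 (hlP.mem_of_zpow_mem hlp hd
      (Subgroup.mem_centralizer_singleton_iff.2 hxc.symm))).symm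
  rw [orderOf_dvd_iff_zpow_eq_one.1 hdvd] at hn
  exact commutatorElement_eq_one_iff_commute.1 hn.symm

theorem IsBTGroup.exists_mem_sylow_mul_inv_mem_centralizer (hG : IsBTGroup G) [Fact p.Prime]
    (S : Sylow p G) (hs : IsPElement p s) :
    ∃ t ∈ S, s * t⁻¹ ∈ centralizer (nilpotentResidual G : Set G) := by
  obtain ⟨T, hsT⟩ := hs.exists_mem_sylow
  obtain ⟨g, rfl⟩ := MulAction.exists_smul_eq G T S
  refine ⟨g * s * g⁻¹, Subgroup.smul_mem_pointwise_smul s (MulAut.conj g) _ hsT, ?_⟩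
  rw [show s * (g * s * g⁻¹)⁻¹ = ⁅s, g⁆ by rw [commutatorElement_def]; group]
  exact hG.commutator_mem_centralizer_nilpotentResidual s g

theorem IsBTGroup.exists_zpow_mul_commute (hG : IsBTGroup G) (hp : p.Prime)
    (hpL : ¬ p ∣ Nat.card (nilpotentResidual G)) (hx : HasCentralizingCofactor p x)
    (hs : IsPElement p s) : ∃ i : ℤ, ∀ l ∈ nilpotentResidual G, (orderOf l).Prime →
      ¬ Commute x l → Commute (x ^ (-i) * s) l := by
  have := Fact.mk hp
  obtain ⟨K, -, ⟨S, hS⟩, hcomm⟩ := hx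
  obtain ⟨t, htS, hst⟩ := hG.exists_mem_sylow_mul_inv_mem_centralizer S hs
  obtain ⟨_, ⟨i, rfl⟩, k, hk, hik : x ^ i * k = t⟩ := hS.subset htS
  refine ⟨i, fun l hl hlp hxl ↦ ?_⟩
  have hC : (centralizer (nilpotentResidual G : Set G)).Normal := inferInstance
  have hcl : Commute (x ^ (-i) * (s * t⁻¹) * (x ^ (-i))⁻¹) l :=
    (Subgroup.mem_centralizer_iff.1 (hC.conj_mem _ hst _) l hl).symm
  rw [show x ^ (-i) * s = x ^ (-i) * (s * t⁻¹) * (x ^ (-i))⁻¹ * k by rw [← hik]; group]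
  exact hcl.mul_left (hG.commute_of_not_commute hp hpL hcomm hk hl hlp hxl)

theorem IsBTGroup.commute_zpow_of_dvd (hG : IsBTGroup G) (hp : p.Prime)
    (hpL : ¬ p ∣ Nat.card (nilpotentResidual G)) (hx : IsPElement p x) {n : ℤ}
    (hn : (p : ℤ) ∣ n) (hxn : HasCentralizingCofactor p (x ^ n))
    (hl : l ∈ nilpotentResidual G) (hlp : (orderOf l).Prime) : Commute (x ^ n) l := by
  by_contra hnl
  obtain ⟨i, hi⟩ := hG.exists_zpow_mul_commute hp hpL hxn hx
  have hil : Commute (x ^ (1 - n * i)) l := by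
    have := hi l hl hlp hnl
    rwa [← zpow_mul, ← zpow_add_one, show n * -i + 1 = 1 - n * i by ring] at this
  have hpn : ¬ (p : ℤ) ∣ 1 - n * i := fun hd ↦
    (Nat.prime_iff_prime_int.1 hp).not_dvd_one ((dvd_sub_left (hn.mul_right i)).1 hd)
  have hxl := hx.mem_of_zpow_mem hp hpn (Subgroup.mem_centralizer_singleton_iff.2 hil)
  exact hnl (Commute.zpow_left (Subgroup.mem_centralizer_singleton_iff.1 hxl) n)

/- Take `b ∈ S` commuting with neither `l` nor `l₀`; modulo elements commuting with both, `x` is a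
power `b ^ i`. As `b ^ i` commutes with `l`, `p ∣ i`, so that `b ^ i` commutes with `l₀` as well. -/
theorem IsBTGroup.commute_of_commute_of_not_commute (hG : IsBTGroup G) (hp : p.Prime)
    (hpL : ¬ p ∣ Nat.card (nilpotentResidual G))
    (h : ∀ x : G, IsPElement p x → HasCentralizingCofactor p x) (S : Sylow p G) (hx : x ∈ S)
    (ht : t ∈ S) (hl : l ∈ nilpotentResidual G) (hlp : (orderOf l).Prime)
    (hl₀ : l₀ ∈ nilpotentResidual G) (hl₀p : (orderOf l₀).Prime) (hxl : Commute x l)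
    (hxl₀ : ¬ Commute x l₀) : Commute t l := by
  by_contra htl
  obtain ⟨b, hb, hbl, hbl₀⟩ : ∃ b ∈ S, ¬ Commute b l ∧ ¬ Commute b l₀ := by
    by_cases htl₀ : Commute t l₀
    · refine ⟨x * t, mul_mem hx ht, fun hc ↦ htl ?_, fun hc ↦ hxl₀ ?_⟩
      · simpa using hxl.inv_left.mul_left hc
      · simpa using hc.mul_left htl₀.inv_left
    · exact ⟨t, ht, htl, htl₀⟩
  have hbp := isPElement_of_mem S.isPGroup' hb
  obtain ⟨i, hi⟩ := hG.exists_zpow_mul_commute hp hpL (h b hbp) (isPElement_of_mem S.isPGroup' hx)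
  have hil : Commute (b ^ i) l := by simpa using hxl.mul_left (hi l hl hlp hbl).inv_left
  have hpi : (p : ℤ) ∣ i := by
    by_contra hd
    exact hbl (Subgroup.mem_centralizer_singleton_iff.1
      (hbp.mem_of_zpow_mem hp hd (Subgroup.mem_centralizer_singleton_iff.2 hil)))
  have hil₀ := hG.commute_zpow_of_dvd hp hpL hbp hpi (h _ (hbp.zpow i)) hl₀ hl₀p
  exact hxl₀ (by simpa using hil₀.mul_left (hi l₀ hl₀ hl₀p hbl₀))

theorem IsBTGroup.exists_zpow_mul_mem_pCore (hG : IsBTGroup G) (hp : p.Prime)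
    (hpL : ¬ p ∣ Nat.card (nilpotentResidual G))
    (h : ∀ x : G, IsPElement p x → HasCentralizingCofactor p x) (S : Sylow p G) (hxS : x ∈ S)
    (hsS : s ∈ S) (hx : x ∉ pCore G p) : ∃ i : ℤ, x ^ (-i) * s ∈ pCore G p := by
  have hxp := isPElement_of_mem S.isPGroup' hxS
  obtain ⟨l₀, hl₀, hl₀p, hxl₀⟩ :
      ∃ l ∈ nilpotentResidual G, (orderOf l).Prime ∧ ¬ Commute x l := by
    by_contra! hc
    exact hx (hG.mem_pCore_of_forall_commute hp hpL hxp hc)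
  obtain ⟨i, hi⟩ := hG.exists_zpow_mul_commute hp hpL (h x hxp) (isPElement_of_mem S.isPGroup' hsS)
  have hwS : x ^ (-i) * s ∈ S := mul_mem (zpow_mem hxS _) hsS
  refine ⟨i, hG.mem_pCore_of_forall_commute hp hpL (isPElement_of_mem S.isPGroup' hwS)
    fun l hl hlp ↦ ?_⟩
  by_cases hxl : Commute x l
  · exact hG.commute_of_commute_of_not_commute hp hpL h S hxS hwS hl hlp hl₀ hl₀p hxl hxl₀
  · exact hi l hl hlp hxl

end CentralizingCofactor

section NoncoreSupplement

variable {G : Type*} [Group G] {p : ℕ} {x : G} {H K : Subgroup G}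

/-- The primes `p` not dividing the order of the nilpotent residual for which `H` has a `p`-element
outside `O_p(G)`. -/
def noncorePrimes (H : Subgroup G) : Set ℕ :=
  {p | p.Prime ∧ ¬ p ∣ Nat.card (nilpotentResidual G) ∧ ∃ x ∈ H, IsPElement p x ∧ x ∉ pCore G p}

/-- The intersection of the subgroups `O^p(G) O_p(G)` over the noncore primes `p` of `H`. Under
condition (3) of the theorem it is a supplement witnessing that `H` is SS-permutable. -/
def noncoreSupplement (H : Subgroup G) : Subgroup G :=
  ⨅ p : noncorePrimes H, pResidual G p ⊔ pCore G p

instance noncoreSupplement_normal : (noncoreSupplement H).Normal :=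
  Subgroup.normal_iInf_normal fun _ ↦ inferInstance

theorem pCore_le_map_sylow (hK : pCore G p ≤ K) (Q : Sylow p K) :
    pCore G p ≤ (Q : Subgroup K).map K.subtype := by
  have hQ : (pCore G p).subgroupOf K ≤ Q :=
    isPGroup_pCore.comap_subtype.le_sylow_of_normal Q
  exact Subgroup.map_subgroupOf_eq_of_le hK ▸ Subgroup.map_mono hQ

variable [Finite G]

theorem mem_noncoreSupplement_iff (hp : p.Prime) (hx : IsPElement p x) :
    x ∈ noncoreSupplement H ↔ (p ∈ noncorePrimes H → x ∈ pCore G p) := by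
  rw [noncoreSupplement, Subgroup.mem_iInf]
  refine ⟨fun h hpH ↦ mem_of_mem_sup_of_coprime (h ⟨p, hpH⟩) ?_, fun h ⟨q, hqH⟩ ↦ ?_⟩
  · exact hx.coprime_orderOf (hp.coprime_iff_not_dvd.2 (not_dvd_card_pResidual hp hpH.2.1))
  · obtain rfl | hqp := eq_or_ne q p
    · exact Subgroup.mem_sup_right (h hqH)
    · exact Subgroup.mem_sup_left <| mem_pResidual <|
        hx.coprime_orderOf ((Nat.coprime_primes hp hqH.1).2 hqp.symm)

theorem pCore_le_noncoreSupplement (hp : p.Prime) : pCore G p ≤ noncoreSupplement H := fun _ hx ↦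
  (mem_noncoreSupplement_iff hp (isPElement_of_mem isPGroup_pCore hx)).2 fun _ ↦ hx

theorem map_sylow_noncoreSupplement (hp : p ∈ noncorePrimes H)
    (Q : Sylow p (noncoreSupplement H)) :
    (Q : Subgroup (noncoreSupplement H)).map (noncoreSupplement H).subtype = pCore G p := by
  refine le_antisymm (fun y hy ↦ ?_) (pCore_le_map_sylow (pCore_le_noncoreSupplement hp.1) Q)
  exact (mem_noncoreSupplement_iff hp.1 (isPElement_of_mem (Q.isPGroup'.map _) hy)).1
    (Subgroup.map_subtype_le _ hy) hp

variable [IsMulCommutative (nilpotentResidual G)]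

theorem IsBTGroup.isSupplement_noncoreSupplement (hG : IsBTGroup G)
    (h : ∀ p ∈ noncorePrimes H, ∀ x : G, IsPElement p x → HasCentralizingCofactor p x) :
    IsSupplement H (noncoreSupplement H) := by
  refine isSupplement_of_sup_eq_top (eq_top_of_forall_sylow_le fun r hr ↦ ?_)
  by_cases hrH : r ∈ noncorePrimes H
  · have := Fact.mk hr
    obtain ⟨x, hxH, hxr, hx⟩ := hrH.2.2
    obtain ⟨S, hxS⟩ := hxr.exists_mem_sylow
    refine ⟨S, fun s hs ↦ ?_⟩
    obtain ⟨i, hi⟩ := hG.exists_zpow_mul_mem_pCore hr hrH.2.1 (h r hrH) S hxS hs hx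
    have := Subgroup.mul_mem_sup (zpow_mem hxH i) (pCore_le_noncoreSupplement (H := H) hr hi)
    rwa [zpow_neg, mul_inv_cancel_left] at this
  · exact ⟨Classical.arbitrary _, fun s hs ↦ Subgroup.mem_sup_right <|
      (mem_noncoreSupplement_iff hr (isPElement_of_mem (Sylow.isPGroup' _) hs)).2 (absurd · hrH)⟩

theorem IsBTGroup.permutes_map_sylow_noncoreSupplement (hG : IsBTGroup G) (hp : p.Prime)
    (Q : Sylow p (noncoreSupplement H)) :
    Permutes H ((Q : Subgroup (noncoreSupplement H)).map (noncoreSupplement H).subtype) := by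
  have hQ := Q.isPGroup'.map (noncoreSupplement H).subtype
  refine permutes_of_forall_isPElement fun r hr x hxH hxr ↦ ?_
  obtain rfl | hrp := eq_or_ne r p
  · by_cases hrL : r ∣ Nat.card (nilpotentResidual G)
    · have := hG.normal_of_le_nilpotentResidual fun y hy ↦
        hG.mem_nilpotentResidual_of_dvd hp hrL (isPElement_of_mem hQ hy)
      exact permutes_of_normal_right _ _
    by_cases hx : x ∈ pCore G r
    · exact permutes_of_le (Subgroup.zpowers_le.2
        (pCore_le_map_sylow (pCore_le_noncoreSupplement hp) Q hx))
    · rw [map_sylow_noncoreSupplement ⟨hp, hrL, x, hxH, hxr, hx⟩ Q]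
      exact permutes_of_normal_right _ _
  · exact hG.permutes_of_isPGroup_of_ne hr hp hrp hxr.isPGroup_zpowers hQ

theorem IsBTGroup.isSSPermutable_of_forall_hasCentralizingCofactor (hG : IsBTGroup G)
    (h : ∀ p : ℕ, p.Prime → p ∣ Nat.card G → ¬ p ∣ Nat.card (nilpotentResidual G) →
      ∀ x : G, IsPElement p x → HasCentralizingCofactor p x) (H : Subgroup G) :
    IsSSPermutable H := by
  refine ⟨noncoreSupplement H, hG.isSupplement_noncoreSupplement fun p hp ↦ ?_,
    fun p hp Q ↦ hG.permutes_map_sylow_noncoreSupplement hp Q⟩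
  obtain ⟨x, hxH, hxp, hx⟩ := hp.2.2
  have hpH := hxp.dvd_natCard hp.1 (fun h1 ↦ hx (h1 ▸ one_mem _)) hxH
  exact h p hp.1 (hpH.trans H.card_subgroup_dvd_card) hp.2.1

end NoncoreSupplement

end SSPerm

theorem theoremF (G : Type*) [Group G] [Finite G] (hsolv : Group.IsSolvable G)
    (hBT : SSPerm.IsBTGroup G) :
    List.TFAE
      [SSPerm.IsSSTGroup G,
       ∀ p : ℕ, p.Prime → p ∣ Nat.card G → ¬ p ∣ Nat.card (SSPerm.nilpotentResidual G) →
         ∀ P : Subgroup G, IsPGroup p P →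
           ∃ K : Subgroup G, IsPGroup p K ∧ SSPerm.IsSylowProduct p P K ∧
             ⁅P, SSPerm.conjClosure K (SSPerm.nilpotentResidual G)⁆ ≤ SSPerm.pCore G p,
       ∀ p : ℕ, p.Prime → p ∣ Nat.card G → ¬ p ∣ Nat.card (SSPerm.nilpotentResidual G) →
         ∀ x : G, (∃ n : ℕ, orderOf x = p ^ n) →
           ∃ K : Subgroup G, IsPGroup p K ∧
             SSPerm.IsSylowProduct p (Subgroup.zpowers x) K ∧
             SSPerm.elemCommutator x
               (SSPerm.conjClosure K (SSPerm.nilpotentResidual G)) ≤ SSPerm.pCore G p] := by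
  have := hBT.isMulCommutative_nilpotentResidual hsolv
  tfae_have 1 → 2 := fun hT p hp _ hpL P hP ↦
    hBT.exists_isSylowProduct_of_isSSPermutable hp hpL hP
      (hBT.isSSPermutable_of_isPGroup hT hp hpL hP)
  tfae_have 2 → 3 := by
    rintro h p hp hpG hpL x ⟨n, hn⟩
    have hx : SSPerm.IsPElement p x := ⟨n, hn ▸ pow_orderOf_eq_one x⟩
    obtain ⟨K, hK, hprod, hcomm⟩ := h p hp hpG hpL _ hx.isPGroup_zpowers
    exact ⟨K, hK, hprod, (SSPerm.elemCommutator_le_commutator x).trans hcomm⟩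
  tfae_have 3 → 1 := fun h H _ _ _ _ ↦
    hBT.isSSPermutable_of_forall_hasCentralizingCofactor (fun p hp hpG hpL x hx ↦
      have := Fact.mk hp
      h p hp hpG hpL x (exists_orderOf_eq_prime_pow_iff.2 hx)) H
  tfae_finish
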